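/- **Model.** A user sits at the origin of the plane. Small base stations (cells) form a homogeneous Poisson point process of density $\rho_f>0$. Independently of each other and of the locations, at the time of the request a cell is idle, active or asleep with probabilities $p_I>0$, $p_A>0$, $p_S\ge 0$, $p_I+p_A+p_S=1$. An idle cell is available at once; an active cell becomes available after a residual time with law $\mathrm{Exp}(\mu)$, a sleeping cell after a residual time with law $\mathrm{Exp}(\lambda_S)$, where $\mu,\lambda_S>0$. Let $R_{th}>0$ be the threshold distance and $w\ge 0$ the tolerable delay. The serving cell of the user is determined as follows. * Immediate access: if some cell within distance $R_{th}$ is idle, it is the nearest idle cell. * Delayed access: otherwise, if some cell within distance $R_{th}$ becomes available within time $w$, it is the first such cell to become available. * Access outside the threshold: otherwise it is the nearest idle cell (which lies beyond $R_{th}$). Let $r$ be the distance to the serving cell. The interferers, that is, the active cells other than the serving one at the time of access, form a homogeneous Poisson point process $\Phi_A$ of density $p_A\rho_f$ in the whole plane, at distances $r_i$ from the user, with fading gains $g_i$ that are i.i.d. exponential with mean $1/\zeta$ and independent of the locations; the gain $h$ of the serving link is exponential with mean $1/\zeta$, where $\zeta>0$. The cells with their modes and residual times, the interferers with their gains, and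 $h$ are independent of each other. With transmit power $P_{tx}>0$, path-loss exponent $\alpha$ and noise power $\sigma^2$, $$\mathrm{SINR}=\frac{P_{tx}\,h\,r^{-\alpha}}{\sum_{i\in\Phi_A}P_{tx}\,g_i\,r_i^{-\alpha}+\sigma^2},$$ and for a threshold $\gamma>0$ the coverage probability is $p_c=\mathbb P(\mathrm{SINR}>\gamma)$. **Theorem.** For $\alpha=4$ and $\sigma^2=0$, $$p_c=\frac{\beta_0}{\theta+\beta_0}+\left(e^{-\beta_0 v}-e^{-\beta_w v}\right)\left[\frac{1}{\theta v}-e^{-\theta v}\left(\frac{\beta_0}{\theta+\beta_0}+\frac{1}{\theta v}\right)\right],$$ where $\theta=p_A\sqrt{\gamma}\,\pi/2$, $v=\rho_f\pi R_{th}^2$, and $\beta_t=1-p_Ae^{-\mu t}-p_Se^{-\lambda_S t}$ for $t\ge 0$ (so that $\beta_0=p_I$). -/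

import Mathlib

open MeasureTheory ProbabilityTheory
open scoped ENNReal

noncomputable section

/-! ### Poisson point processes -/

/-- The number of points of the random point set `Φ` that lie in `B`. -/
def pointCount {Ω X : Type*} (Φ : Ω → Set X) (B : Set X) (ω : Ω) : ℕ∞ :=
  (Φ ω ∩ B).encard

/-- The random point set `Φ` on `X` is a Poisson point process with intensity measure `Λ` under
the law `P`: the number of points in a measurable set `B` with `Λ B < ∞` is a Poisson random
variable of mean `Λ B`, and the numbers of points in pairwise disjoint measurable sets are
independent. (Point sets are simple, so this is meant for atomless `Λ`; a Poisson process of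
intensity `Λ` whose points carry i.i.d. marks of law `ν`, independent of the locations, is a Poisson
process of intensity `Λ.prod ν` on location-mark pairs.) -/
structure IsPoissonPP {Ω X : Type*} [MeasurableSpace Ω] [MeasurableSpace X]
    (Φ : Ω → Set X) (Λ : Measure X) (P : Measure Ω) : Prop where
  measurable_count : ∀ B : Set X, MeasurableSet B → Measurable (pointCount Φ B)
  poisson_count : ∀ B : Set X, MeasurableSet B → Λ B ≠ ∞ → ∀ k : ℕ,
    P {ω | pointCount Φ B ω = (k : ℕ∞)} = poissonMeasure (Λ B).toNNReal {k}
  indep_count : ∀ (n : ℕ) (B : Fin n → Set X), (∀ i, MeasurableSet (B i)) →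
    Pairwise (fun i j => Disjoint (B i) (B j)) → iIndepFun (fun i => pointCount Φ (B i)) P

/-- The σ-algebra generated by a random point set, i.e. by all its counting variables. -/
@[reducible] def pointSigma {Ω X : Type*} [MeasurableSpace X] (Φ : Ω → Set X) : MeasurableSpace Ω :=
  ⨆ (B : Set X) (_ : MeasurableSet B), MeasurableSpace.comap (pointCount Φ B) inferInstance

/-! ### The small base stations -/

/-- The Euclidean plane; the user sits at the origin. -/
abbrev Plane : Type := EuclideanSpace ℝ (Fin 2)

/-- The three operation modes of a small base station. -/
inductive Mode where
  | idle
  | active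
  | sleep

instance : MeasurableSpace Mode := ⊤

/-- A base station: its location, its mode at the time of the request, and the time that passes
from the request until it is available. -/
abbrev Cell : Type := Plane × Mode × ℝ

/-- The location of a cell. -/
def Cell.loc (c : Cell) : Plane := c.1

/-- The mode of a cell at the time of the request. -/
def Cell.mode (c : Cell) : Mode := c.2.1

/-- The time from the request until the cell is available. -/
def Cell.wait (c : Cell) : ℝ := c.2.2

/-- Joint law of mode and waiting time of a cell: with probability `pI` it is idle and available
at once; with probability `pA` it is active, with residual service time `Exp(μ)`; with probability
`pS` it is asleep, with residual sleep time `Exp(lamS)`. -/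
def modeWaitLaw (pI pA pS μ lamS : ℝ) : Measure (Mode × ℝ) :=
  ENNReal.ofReal pI • Measure.dirac (Mode.idle, (0 : ℝ))
    + ENNReal.ofReal pA • (Measure.dirac Mode.active).prod (expMeasure μ)
    + ENNReal.ofReal pS • (Measure.dirac Mode.sleep).prod (expMeasure lamS)

/-- Intensity of the marked network: locations have density `ρ` in the plane, and the cells carry
i.i.d. marks of law `modeWaitLaw`. -/
def cellIntensity (ρ pI pA pS μ lamS : ℝ) : Measure Cell :=
  (ENNReal.ofReal ρ • (volume : Measure Plane)).prod (modeWaitLaw pI pA pS μ lamS)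

/-- Intensity of the interferers: active base stations of density `pA * ρ` in the plane, each with
an independent fading gain `Exp(ζ)` as its mark. -/
def interfererIntensity (ρ pA ζ : ℝ) : Measure (Plane × ℝ) :=
  (ENNReal.ofReal (pA * ρ) • (volume : Measure Plane)).prod (expMeasure ζ)

/-! ### Delayed access -/

/-- Immediate access: some cell within the threshold distance `R` is idle, and `b` is the nearest
idle cell. -/
def ImmediateAccess (S : Set Cell) (R : ℝ) (b : Cell) : Prop :=
  b ∈ S ∧ b.mode = Mode.idle ∧ ‖b.loc‖ ≤ R ∧
    ∀ c ∈ S, c.mode = Mode.idle → ‖b.loc‖ ≤ ‖c.loc‖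

/-- Delayed access: no cell within the threshold distance `R` is idle, but some cell there becomes
available within the tolerable delay `w`, and `b` is the first one that does. -/
def DelayedAccess (S : Set Cell) (R w : ℝ) (b : Cell) : Prop :=
  (∀ c ∈ S, ‖c.loc‖ ≤ R → c.mode ≠ Mode.idle) ∧
    b ∈ S ∧ ‖b.loc‖ ≤ R ∧ b.wait ≤ w ∧ ∀ c ∈ S, ‖c.loc‖ ≤ R → b.wait ≤ c.wait

/-- Access outside the threshold: no cell within the threshold distance `R` is idle or becomes
available within the tolerable delay `w`, and `b` is the nearest idle cell (beyond `R`). -/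
def OutsideAccess (S : Set Cell) (R w : ℝ) (b : Cell) : Prop :=
  (∀ c ∈ S, ‖c.loc‖ ≤ R → c.mode ≠ Mode.idle ∧ w < c.wait) ∧
    b ∈ S ∧ b.mode = Mode.idle ∧ R < ‖b.loc‖ ∧
    ∀ c ∈ S, c.mode = Mode.idle → ‖b.loc‖ ≤ ‖c.loc‖

/-- `b` is the serving cell of the user under the delayed access scheme. -/
def IsServing (S : Set Cell) (R w : ℝ) (b : Cell) : Prop :=
  ImmediateAccess S R b ∨ DelayedAccess S R w b ∨ OutsideAccess S R w b

/-- The distance from the user to the serving cell. (In the Poisson network with idle cells the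
serving cell exists and is unique almost surely, so the infimum is over a single number.) -/
def servingDist (S : Set Cell) (R w : ℝ) : ℝ :=
  sInf {r | ∃ b, IsServing S R w b ∧ ‖b.loc‖ = r}

/-! ### Signal to interference and noise ratio -/

/-- Total received power from the interferers `T` (pairs of location and fading gain). -/
def interferencePower (Ptx α : ℝ) (T : Set (Plane × ℝ)) : ℝ≥0∞ :=
  ∑' p : T, ENNReal.ofReal (Ptx * p.1.2 * ‖p.1.1‖ ^ (-α))

/-- The SINR at serving distance `r` and serving-link fading gain `h`, with path-loss exponent `α`
and noise power `σ2`; it is `∞` if there is signal but neither noise nor interference. -/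
def sinr (Ptx α σ2 h r : ℝ) (T : Set (Plane × ℝ)) : ℝ≥0∞ :=
  ENNReal.ofReal (Ptx * h * r ^ (-α)) / (interferencePower Ptx α T + ENNReal.ofReal σ2)

/-- The coverage probability `P(SINR > γ)` of the user, for the network `Φ`, the set `Ψ` of
interferers and the serving-link fading gain `h`. -/
def coverageProb {Ω : Type*} [MeasurableSpace Ω] (P : Measure Ω) (Φ : Ω → Set Cell)
    (Ψ : Ω → Set (Plane × ℝ)) (h : Ω → ℝ) (Ptx α σ2 R w γ : ℝ) : ℝ :=
  P.real {ω | ENNReal.ofReal γ < sinr Ptx α σ2 (h ω) (servingDist (Φ ω) R w) (Ψ ω)}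

end

/-! ### Elementary properties of Poisson point processes -/

/-! The proof separates the fading and interference from the law of the serving distance `r`.

Given `r` and the interference, coverage asks that the exponential gain `h` exceed a multiple of the
interference, which has conditional probability `exp (-s I)`. Averaging over the interferers yields
the Laplace functional of a Poisson process (`IsPoissonPP.lintegral_expNeg_pointSum`). For `α = 4`,
in the area variable `u = π ‖x‖ ^ 2`, its exponent is an integral of `b ^ 2 / (u ^ 2 + b ^ 2)`,
evaluated by an arctangent. Hence the coverage probability is the mean of `exp (-θ ρ π r ^ 2)`
(`measure_covered`).

For the law of `r`, the three access rules merge into one: the serving cell is the candidate of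
lowest `cellScore` (`isServing_iff_isFirstPoint`). In a Poisson process the lowest-scoring point has
density, relative to the intensity, equal to the probability that no candidate has a smaller score;
this is `firstPointLaw`. Integrating `exp (-κ π r ^ 2)` against it splits into near idle cells,
delayed cells and far idle cells (`lintegral_firstPointLaw_area`). A delayed cell is chosen by its
waiting time alone, so its location is uniform in the disc; the time integrand is an exact
derivative.

Existence of a lowest-scoring point in a given set is not evidently a measurable event, so only
upper bounds by measurable covers are proved. Since `firstPointLaw` has total mass one, the bounds
for a set and its complement leave no slack, and the exact law follows
(`IsPoissonPP.exists_measurable_firstPoint`). -/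

theorem measurable_pointCount_pointSigma {Ω X : Type*} [MeasurableSpace X] (Φ : Ω → Set X)
    {B : Set X} (hB : MeasurableSet B) : Measurable[pointSigma Φ] (pointCount Φ B) :=
  (comap_measurable (pointCount Φ B)).mono
    (le_iSup₂ (f := fun (B : Set X) (_ : MeasurableSet B) =>
      MeasurableSpace.comap (pointCount Φ B) inferInstance) B hB) le_rfl

theorem pointCount_ne_zero_iff {Ω X : Type*} {Φ : Ω → Set X} (B : Set X) (ω : Ω) :
    pointCount Φ B ω ≠ 0 ↔ (Φ ω ∩ B).Nonempty := by
  simp [pointCount, Set.nonempty_iff_ne_empty]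

section PoissonProcess

variable {Ω X : Type*} [MeasurableSpace Ω] [MeasurableSpace X]
  {Φ : Ω → Set X} {Λ : Measure X} {P : Measure Ω}

theorem IsPoissonPP.pointSigma_le (hΦ : IsPoissonPP Φ Λ P) : pointSigma Φ ≤ ‹MeasurableSpace Ω› :=
  iSup₂_le fun B hB => (hΦ.measurable_count B hB).comap_le

theorem IsPoissonPP.measure_count_eq_zero (hΦ : IsPoissonPP Φ Λ P) {B : Set X}
    (hB : MeasurableSet B) (hfin : Λ B ≠ ∞) :
    P {ω | pointCount Φ B ω = 0} = ENNReal.ofReal (Real.exp (-(Λ B).toReal)) := by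
  have h := hΦ.poisson_count B hB hfin 0
  rw [poissonMeasure_singleton] at h
  simpa [ENNReal.coe_toNNReal_eq_toReal] using h

/-- This is `1 - exp (-x) ≤ x`. The loss is of second order, so it disappears when the score is
discretised ever more finely. -/
theorem IsPoissonPP.measure_count_ne_zero_le [IsProbabilityMeasure P] (hΦ : IsPoissonPP Φ Λ P)
    {B : Set X} (hB : MeasurableSet B) : P {ω | pointCount Φ B ω ≠ 0} ≤ Λ B := by
  by_cases hfin : Λ B = ∞
  · simp [hfin]
  have hm : MeasurableSet {ω | pointCount Φ B ω = 0} :=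
    hΦ.measurable_count B hB (measurableSet_singleton 0)
  have hc : {ω | pointCount Φ B ω ≠ 0} = {ω | pointCount Φ B ω = 0}ᶜ := rfl
  rw [hc, prob_compl_eq_one_sub hm, hΦ.measure_count_eq_zero hB hfin, ← ENNReal.ofReal_one,
    ← ENNReal.ofReal_sub _ (Real.exp_pos _).le]
  refine ENNReal.ofReal_le_of_le_toReal ?_
  linarith [Real.add_one_le_exp (-(Λ B).toReal)]

theorem IsPoissonPP.ae_notMem_of_null [IsProbabilityMeasure P] (hΦ : IsPoissonPP Φ Λ P)
    {B : Set X} (hB : Λ B = 0) : ∀ᵐ ω ∂P, ∀ x ∈ Φ ω, x ∉ B := by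
  have h := hΦ.measure_count_ne_zero_le (measurableSet_toMeasurable Λ B)
  rw [measure_toMeasurable, hB, nonpos_iff_eq_zero] at h
  filter_upwards [measure_eq_zero_iff_ae_notMem.mp h] with ω hω x hx hxB
  exact hω ((pointCount_ne_zero_iff _ _).2 ⟨x, hx, subset_toMeasurable Λ B hxB⟩)

/-- The definition prescribes only the probabilities of finite counts. These already sum to one, so
nothing is left for `⊤`; accordingly an inequality between two probability measures suffices. -/
theorem IsPoissonPP.map_pointCount [IsProbabilityMeasure P] (hΦ : IsPoissonPP Φ Λ P)
    {B : Set X} (hB : MeasurableSet B) (hfin : Λ B ≠ ∞) :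
    P.map (pointCount Φ B) = (poissonMeasure (Λ B).toNNReal).map (fun n : ℕ => (n : ℕ∞)) := by
  have hmeas := hΦ.measurable_count B hB
  have : IsProbabilityMeasure (P.map (pointCount Φ B)) :=
    Measure.isProbabilityMeasure_map hmeas.aemeasurable
  have hcast : Measurable (fun n : ℕ => (n : ℕ∞)) := measurable_from_top
  have : IsProbabilityMeasure
      ((poissonMeasure (Λ B).toNNReal).map (fun n : ℕ => (n : ℕ∞))) :=
    Measure.isProbabilityMeasure_map hcast.aemeasurable
  symm
  refine Measure.eq_of_le_of_isProbabilityMeasure (Measure.le_iff.2 fun s hs => ?_)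
  rw [Measure.map_apply hcast hs, Measure.map_apply hmeas hs]
  have hsub : (⋃ k ∈ (fun n : ℕ => (n : ℕ∞)) ⁻¹' s, {ω | pointCount Φ B ω = (k : ℕ∞)}) ⊆
      pointCount Φ B ⁻¹' s := by
    simp only [Set.iUnion_subset_iff]
    intro k hk ω hω
    simpa [Set.mem_preimage, hω.out] using hk
  refine le_trans (le_of_eq ?_) (measure_mono hsub)
  rw [measure_biUnion (Set.to_countable _)]
  · rw [← Measure.tsum_indicator_apply_singleton _ _ (by exact MeasurableSet.of_discrete),
      tsum_subtype ((fun n : ℕ => (n : ℕ∞)) ⁻¹' s)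
        (fun k : ℕ => P {ω | pointCount Φ B ω = (k : ℕ∞)})]
    refine tsum_congr fun k => ?_
    simp only [Set.indicator, hΦ.poisson_count B hB hfin k]
  · intro i _ j _ hij
    refine Set.disjoint_left.2 fun ω h1 h2 => hij ?_
    exact_mod_cast h1.out.symm.trans h2.out
  · intro k _
    exact hmeas (measurableSet_singleton _)

theorem IsPoissonPP.ae_finite_inter [IsProbabilityMeasure P] (hΦ : IsPoissonPP Φ Λ P)
    {B : Set X} (hB : MeasurableSet B) (hfin : Λ B ≠ ∞) : ∀ᵐ ω ∂P, (Φ ω ∩ B).Finite := by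
  have hmeas := hΦ.measurable_count B hB
  have h : ∀ᵐ n ∂(P.map (pointCount Φ B)), n ≠ ⊤ := by
    rw [hΦ.map_pointCount hB hfin,
      ae_map_iff measurable_from_top.aemeasurable (by exact MeasurableSet.of_discrete)]
    simp
  filter_upwards [ae_of_ae_map hmeas.aemeasurable h] with ω hω
  exact Set.encard_ne_top_iff.1 hω

theorem IsPoissonPP.indepFun_count (hΦ : IsPoissonPP Φ Λ P) {B C : Set X} (hB : MeasurableSet B)
    (hC : MeasurableSet C) (hBC : Disjoint B C) :
    IndepFun (pointCount Φ B) (pointCount Φ C) P := by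
  have h := hΦ.indep_count 2 ![B, C] (by simp [Fin.forall_fin_two, hB, hC])
    (by
      intro i j hij
      fin_cases i <;> fin_cases j <;> simp_all [disjoint_comm])
  exact h.indepFun (i := 0) (j := 1) (by simp)

end PoissonProcess

/-! ### The point of lowest score -/

section FirstPoint

open Filter Topology

variable {Ω X : Type*} [MeasurableSpace Ω] [MeasurableSpace X]
  {Φ : Ω → Set X} {Λ : Measure X} {P : Measure Ω}

/-- The probability that a Poisson process of intensity `Λ` has no point in `G` of score less
than `s`. -/
noncomputable def scoreTail (Λ : Measure X) (G : Set X) (τ : X → ℝ) (s : ℝ) : ℝ≥0∞ :=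
  ENNReal.ofReal (Real.exp (-(Λ (G ∩ {y | τ y < s})).toReal))

/-- The law of the point of `G` with the lowest score `τ` in a Poisson process of intensity `Λ`. -/
noncomputable def firstPointLaw (Λ : Measure X) (G : Set X) (τ : X → ℝ) : Measure X :=
  (Λ.restrict G).withDensity fun x => scoreTail Λ G τ (τ x)

/-- `b` is a point of `S` in `G` with the lowest score. -/
def IsFirstPoint (S G : Set X) (τ : X → ℝ) (b : X) : Prop :=
  b ∈ S ∧ b ∈ G ∧ ∀ c ∈ S, c ∈ G → τ b ≤ τ c

theorem scoreTail_antitone {G : Set X} {τ : X → ℝ} (hfin : ∀ s, Λ (G ∩ {y | τ y < s}) ≠ ∞) :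
    Antitone (scoreTail Λ G τ) := by
  intro s t hst
  refine ENNReal.ofReal_le_ofReal (Real.exp_le_exp.2 (neg_le_neg ?_))
  exact ENNReal.toReal_mono (hfin t)
    (measure_mono (Set.inter_subset_inter_right _ fun y hy => lt_of_lt_of_le hy hst))

theorem scoreTail_le_one (G : Set X) (τ : X → ℝ) (s : ℝ) : scoreTail Λ G τ s ≤ 1 := by
  refine ENNReal.ofReal_le_one.2 (Real.exp_le_one_iff.2 ?_)
  simp

/-- The strict inequality in `scoreTail` makes it left-continuous, which is what approximation of a
score by rounding down requires. -/
theorem tendsto_scoreTail {G : Set X} {τ : X → ℝ} (hG : MeasurableSet G) (hτ : Measurable τ)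
    (hfin : ∀ s, Λ (G ∩ {y | τ y < s}) ≠ ∞) {u : ℕ → ℝ} {s : ℝ} (hle : ∀ n, u n ≤ s)
    (hu : Tendsto u atTop (𝓝 s)) :
    Tendsto (fun n => scoreTail Λ G τ (u n)) atTop (𝓝 (scoreTail Λ G τ s)) := by
  have hmeas : ∀ t, MeasurableSet (G ∩ {y | τ y < t}) := fun t =>
    hG.inter (measurableSet_lt hτ measurable_const)
  have h : Tendsto (fun n => Λ (G ∩ {y | τ y < u n})) atTop (𝓝 (Λ (G ∩ {y | τ y < s}))) := by
    refine tendsto_measure_of_tendsto_indicator atTop (fun n => hmeas _) (hmeas s) (hfin s)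
      (Eventually.of_forall fun n => Set.inter_subset_inter_right _
        fun y hy => lt_of_lt_of_le hy (hle n)) fun x => ?_
    by_cases hx : τ x < s
    · filter_upwards [hu.eventually_const_lt hx] with n hn
      simp [hx, hn]
    · filter_upwards with n
      simp [hx, not_lt.2 ((hle n).trans (not_lt.1 hx))]
  refine ENNReal.tendsto_ofReal ?_
  exact (Real.continuous_exp.tendsto _).comp ((ENNReal.tendsto_toReal (hfin s)).comp h).neg

theorem measurable_scoreTail {G : Set X} {τ : X → ℝ} (hfin : ∀ s, Λ (G ∩ {y | τ y < s}) ≠ ∞) :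
    Measurable (scoreTail Λ G τ) :=
  (scoreTail_antitone hfin).measurable

theorem tendsto_floor_mul_div (t : ℝ) (ht : 0 ≤ t) :
    Tendsto (fun n : ℕ => (⌊((n : ℝ) + 1) * t⌋₊ : ℝ) / ((n : ℝ) + 1)) atTop (𝓝 t) := by
  have h : Tendsto (fun n : ℕ => (n : ℝ) + 1) atTop atTop :=
    tendsto_atTop_add_const_right _ _ tendsto_natCast_atTop_atTop
  have := (tendsto_nat_floor_mul_div_atTop ht).comp h
  simpa [Function.comp_def, mul_comm] using this

/-- Round the score down to multiples of `1 / (n + 1)`. A lowest-scoring point in level `i` forces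
an empty region below that level and an occupied level set. The two regions are disjoint, so the
probabilities multiply, and summing over `i` gives the integral of the tail at the rounded score.
Dominated convergence then removes the rounding. -/
theorem IsPoissonPP.exists_cover_isFirstPoint_of_finite [IsProbabilityMeasure P]
    (hΦ : IsPoissonPP Φ Λ P) {G A : Set X} {τ : X → ℝ} (hG : MeasurableSet G)
    (hA : MeasurableSet A) (hτ : Measurable τ) (hτ0 : ∀ x ∈ G, 0 ≤ τ x)
    (hfin : ∀ s, Λ (G ∩ {y | τ y < s}) ≠ ∞) (hAfin : Λ (A ∩ G) ≠ ∞) :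
    ∃ U, MeasurableSet[pointSigma Φ] U ∧
      (∀ ω, (∃ b ∈ A, IsFirstPoint (Φ ω) G τ b) → ω ∈ U) ∧ P U ≤ firstPointLaw Λ G τ A := by
  set q : ℕ → X → ℝ := fun n x => (⌊((n : ℝ) + 1) * τ x⌋₊ : ℝ) / ((n : ℝ) + 1) with hq
  have hfl : ∀ n : ℕ, Measurable fun x => ⌊((n : ℝ) + 1) * τ x⌋₊ := fun n =>
    Nat.measurable_floor.comp (hτ.const_mul _)
  have hlow : ∀ (n : ℕ) x, x ∈ G → q n x ≤ τ x := by
    intro n x hx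
    have h1 := Nat.floor_le (mul_nonneg (by positivity : (0 : ℝ) ≤ (n : ℝ) + 1) (hτ0 x hx))
    rw [hq]
    simp only
    rw [div_le_iff₀ (by positivity)]
    linarith
  let B : ℕ → ℕ → Set X := fun n i => G ∩ {y | τ y < (i : ℝ) / ((n : ℝ) + 1)}
  let C : ℕ → ℕ → Set X := fun n i => (A ∩ G) ∩ {x | ⌊((n : ℝ) + 1) * τ x⌋₊ = i}
  have hB : ∀ n i, MeasurableSet (B n i) := fun n i =>
    hG.inter (measurableSet_lt hτ measurable_const)
  have hC : ∀ n i, MeasurableSet (C n i) := fun n i =>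
    (hA.inter hG).inter (hfl n (measurableSet_singleton i))
  have hdisj : ∀ n i, Disjoint (B n i) (C n i) := by
    intro n i
    refine Set.disjoint_left.2 fun x hx hx' => ?_
    have h1 := hlow n x hx.1
    have h2 : ⌊((n : ℝ) + 1) * τ x⌋₊ = i := hx'.2
    have h3 : τ x < (i : ℝ) / ((n : ℝ) + 1) := hx.2
    simp only [hq, h2] at h1
    linarith
  let U : ℕ → Set Ω := fun n => ⋃ i,
    ({ω | pointCount Φ (B n i) ω = 0} ∩ {ω | pointCount Φ (C n i) ω ≠ 0})
  have hUmeas : ∀ n, MeasurableSet[pointSigma Φ] (U n) := fun n =>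
    MeasurableSet.iUnion fun i => MeasurableSet.inter
      (measurable_pointCount_pointSigma Φ (hB n i) (measurableSet_singleton 0))
      (measurable_pointCount_pointSigma Φ (hC n i) (measurableSet_singleton 0).compl)
  -- Union bound over the levels; on each level the rounded score is constant, so every term is an
  -- integral over `C n i`.
  have hUle : ∀ n, P (U n) ≤ ∫⁻ x in A ∩ G, scoreTail Λ G τ (q n x) ∂Λ := by
    intro n
    have hcov : A ∩ G = ⋃ i, C n i := by
      ext x; simp [C]
    calc P (U n) ≤ ∑' i, P ({ω | pointCount Φ (B n i) ω = 0} ∩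
          {ω | pointCount Φ (C n i) ω ≠ 0}) := measure_iUnion_le _
      _ ≤ ∑' i, ∫⁻ x in C n i, scoreTail Λ G τ (q n x) ∂Λ := by
        refine ENNReal.tsum_le_tsum fun i => ?_
        have hind := (hΦ.indepFun_count (hB n i) (hC n i) (hdisj n i)).measure_inter_preimage_eq_mul
          {0} {0}ᶜ (measurableSet_singleton 0) (measurableSet_singleton 0).compl
        have hconst : ∫⁻ x in C n i, scoreTail Λ G τ (q n x) ∂Λ
            = scoreTail Λ G τ ((i : ℝ) / ((n : ℝ) + 1)) * Λ (C n i) := by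
          rw [← setLIntegral_const]
          refine setLIntegral_congr_fun (hC n i) fun x hx => ?_
          have h2 : ⌊((n : ℝ) + 1) * τ x⌋₊ = i := hx.2
          simp only [hq, h2]
        rw [hconst]
        refine (le_of_eq hind).trans ?_
        refine mul_le_mul' (le_of_eq ?_) (hΦ.measure_count_ne_zero_le (hC n i))
        exact hΦ.measure_count_eq_zero (hB n i) (hfin _)
      _ = ∫⁻ x in A ∩ G, scoreTail Λ G τ (q n x) ∂Λ := by
        conv_rhs => rw [hcov]
        rw [lintegral_iUnion (hC n)]
        intro i j hij
        refine Set.disjoint_left.2 fun x hx hx' => hij ?_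
        exact hx.2.symm.trans hx'.2
  refine ⟨⋂ n, U n, MeasurableSet.iInter hUmeas, ?_, ?_⟩
  · rintro ω ⟨b, hbA, hbS, hbG, hmin⟩
    refine Set.mem_iInter.2 fun n => Set.mem_iUnion.2 ⟨⌊((n : ℝ) + 1) * τ b⌋₊, ?_, ?_⟩
    · by_contra hne
      obtain ⟨c, hcS, hcG, hc⟩ := (pointCount_ne_zero_iff _ _).1 hne
      exact absurd (hmin c hcS hcG) (not_le.2 (lt_of_lt_of_le hc (hlow n b hbG)))
    · exact (pointCount_ne_zero_iff _ _).2 ⟨b, hbS, ⟨hbA, hbG⟩, rfl⟩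
  · have hlim : Tendsto (fun n => ∫⁻ x in A ∩ G, scoreTail Λ G τ (q n x) ∂Λ) atTop
        (𝓝 (∫⁻ x in A ∩ G, scoreTail Λ G τ (τ x) ∂Λ)) := by
      refine tendsto_lintegral_of_dominated_convergence (fun _ => 1) (fun n => ?_) (fun n => ?_)
        ?_ ?_
      · refine (measurable_scoreTail hfin).comp ?_
        exact (measurable_from_top.comp (hfl n)).div_const _
      · exact Eventually.of_forall fun x => scoreTail_le_one _ _ _
      · simpa using hAfin
      · refine (ae_restrict_iff' (hA.inter hG)).2 (Eventually.of_forall fun x hx => ?_)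
        exact tendsto_scoreTail hG hτ hfin (fun n => hlow n x hx.2)
          (tendsto_floor_mul_div _ (hτ0 x hx.2))
    have hlaw : firstPointLaw Λ G τ A = ∫⁻ x in A ∩ G, scoreTail Λ G τ (τ x) ∂Λ := by
      rw [firstPointLaw, withDensity_apply _ hA, Measure.restrict_restrict hA]
    rw [hlaw]
    exact ge_of_tendsto' hlim fun n => (measure_mono (Set.iInter_subset U n)).trans (hUle n)

/-- Finite intensity of the target set served only to dominate by a constant, so the set is
exhausted by the truncations `τ < K`. The covers for different `K` need not be nested; their lower
limit is an increasing union that still catches every point. -/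
theorem IsPoissonPP.exists_cover_isFirstPoint [IsProbabilityMeasure P]
    (hΦ : IsPoissonPP Φ Λ P) {G A : Set X} {τ : X → ℝ} (hG : MeasurableSet G)
    (hA : MeasurableSet A) (hτ : Measurable τ) (hτ0 : ∀ x ∈ G, 0 ≤ τ x)
    (hfin : ∀ s, Λ (G ∩ {y | τ y < s}) ≠ ∞) :
    ∃ U, MeasurableSet[pointSigma Φ] U ∧
      (∀ ω, (∃ b ∈ A, IsFirstPoint (Φ ω) G τ b) → ω ∈ U) ∧ P U ≤ firstPointLaw Λ G τ A := by
  have hex : ∀ K : ℕ, ∃ U, MeasurableSet[pointSigma Φ] U ∧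
      (∀ ω, (∃ b ∈ A ∩ {x | τ x < K}, IsFirstPoint (Φ ω) G τ b) → ω ∈ U) ∧
      P U ≤ firstPointLaw Λ G τ (A ∩ {x | τ x < K}) := fun K =>
    hΦ.exists_cover_isFirstPoint_of_finite hG
      (hA.inter (measurableSet_lt hτ measurable_const)) hτ hτ0 hfin
      (ne_top_of_le_ne_top (hfin K) (measure_mono fun x hx => ⟨hx.2, hx.1.2⟩))
  choose U hUm hU hUP using hex
  refine ⟨⋃ K, ⋂ j ≥ K, U j, ?_, ?_, ?_⟩
  · exact MeasurableSet.iUnion fun K => MeasurableSet.iInter fun j =>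
      MeasurableSet.iInter fun _ => hUm j
  · rintro ω ⟨b, hbA, hb⟩
    obtain ⟨K, hK⟩ := exists_nat_gt (τ b)
    refine Set.mem_iUnion.2 ⟨K, Set.mem_iInter₂.2 fun j hj => hU j ω ⟨b, ⟨hbA, ?_⟩, hb⟩⟩
    exact hK.trans_le (Nat.cast_le.2 hj)
  · rw [Monotone.measure_iUnion]
    · refine iSup_le fun K => ?_
      exact (measure_mono (Set.iInter₂_subset K le_rfl)).trans
        ((hUP K).trans (measure_mono Set.inter_subset_left))
    · intro K L hKL
      exact Set.biInter_subset_biInter_left fun j hj => le_trans hKL hj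

open scoped Classical in
theorem measurable_iInf_rat_ite {Ω : Type*} {m : MeasurableSpace Ω} {U : ℚ → Set Ω}
    (hU : ∀ q, MeasurableSet (U q)) :
    Measurable fun ω => ⨅ q : ℚ, if ω ∈ U q then ((q : ℝ) : EReal) else ⊤ :=
  Measurable.iInf fun q => Measurable.ite (hU q) measurable_const measurable_const

open scoped Classical in
/-- If `r` almost surely is the value of `d` at a point of lowest score, then `r` is determined by
the process up to null sets, and its law is the image of `firstPointLaw`. -/
theorem IsPoissonPP.exists_measurable_firstPoint [IsProbabilityMeasure P]
    (hΦ : IsPoissonPP Φ Λ P) {G : Set X} {τ d : X → ℝ} (hG : MeasurableSet G)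
    (hτ : Measurable τ) (hτ0 : ∀ x ∈ G, 0 ≤ τ x)
    (hfin : ∀ s, Λ (G ∩ {y | τ y < s}) ≠ ∞) (hd : Measurable d)
    (hprob : firstPointLaw Λ G τ Set.univ = 1) {r : Ω → ℝ}
    (hr : ∀ᵐ ω ∂P, ∃ b, IsFirstPoint (Φ ω) G τ b ∧ d b = r ω) :
    ∃ r' : Ω → ℝ, Measurable[pointSigma Φ] r' ∧ r =ᵐ[P] r' ∧
      P.map r' = (firstPointLaw Λ G τ).map d := by
  have hle := hΦ.pointSigma_le
  have : IsProbabilityMeasure (firstPointLaw Λ G τ) := ⟨hprob⟩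
  have hcover : ∀ s : Set ℝ, MeasurableSet s → ∃ U, MeasurableSet[pointSigma Φ] U ∧
      (∀ᵐ ω ∂P, r ω ∈ s → ω ∈ U) ∧ P U ≤ firstPointLaw Λ G τ (d ⁻¹' s) := by
    intro s hs
    obtain ⟨U, h1, h2, h3⟩ := hΦ.exists_cover_isFirstPoint hG (hd hs) hτ hτ0 hfin
    refine ⟨U, h1, ?_, h3⟩
    filter_upwards [hr] with ω ⟨b, hb, hbr⟩ hω
    exact h2 ω ⟨b, by simpa [hbr] using hω, hb⟩
  -- The covers `U` of `s` and `V` of its complement together exhaust the space, while their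
  -- probabilities add up to at most one. Their overlap is therefore null, and `U` agrees with the
  -- event `r ∈ s` almost surely.
  have hexact : ∀ s : Set ℝ, MeasurableSet s → ∃ U, MeasurableSet[pointSigma Φ] U ∧
      (∀ᵐ ω ∂P, r ω ∈ s ↔ ω ∈ U) ∧ P U ≤ firstPointLaw Λ G τ (d ⁻¹' s) := by
    intro s hs
    obtain ⟨U, h1, h2, h3⟩ := hcover s hs
    obtain ⟨V, g1, g2, g3⟩ := hcover sᶜ hs.compl
    refine ⟨U, h1, ?_, h3⟩
    have hUV : P (U ∩ V) = 0 := by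
      have hun : P (U ∪ V) = 1 := by
        rw [← measure_univ (μ := P)]
        refine measure_congr (eventuallyEq_univ.2 ?_)
        filter_upwards [h2, g2] with ω hU hV
        by_cases hs' : r ω ∈ s
        · exact Or.inl (hU hs')
        · exact Or.inr (hV hs')
      have hsum := measure_union_add_inter (μ := P) U (hle _ g1)
      have htot : firstPointLaw Λ G τ (d ⁻¹' s) + firstPointLaw Λ G τ (d ⁻¹' sᶜ) = 1 := by
        rw [Set.preimage_compl]
        exact prob_add_prob_compl (hd hs)
      have h4 : 1 + P (U ∩ V) ≤ 1 + 0 := by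
        rw [← hun, hsum, hun, add_zero, ← htot]
        exact add_le_add h3 g3
      simpa using (ENNReal.add_le_add_iff_left ENNReal.one_ne_top).1 h4
    filter_upwards [h2, g2, measure_eq_zero_iff_ae_notMem.1 hUV] with ω hU hV hω
    refine ⟨hU, fun hωU => ?_⟩
    by_contra hrs
    exact hω ⟨hωU, hV hrs⟩
  -- The variable is rebuilt as the infimum of the rationals `q` with `r ≤ q`, replacing each such
  -- event by its version in `pointSigma Φ`.
  choose U hUm hU _ using fun q : ℚ => hexact (Set.Iic (q : ℝ)) measurableSet_Iic
  let g : Ω → EReal := fun ω => ⨅ q : ℚ, if ω ∈ U q then ((q : ℝ) : EReal) else ⊤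
  have hg : Measurable[pointSigma Φ] g :=
    measurable_iInf_rat_ite hUm
  have hrg : ∀ᵐ ω ∂P, r ω = (g ω).toReal := by
    filter_upwards [ae_all_iff.2 hU] with ω hω
    have : g ω = ((r ω : ℝ) : EReal) := by
      refine le_antisymm ?_ ?_
      · refine le_of_forall_gt fun c hc => ?_
        obtain ⟨q, hq1, hq2⟩ := EReal.lt_iff_exists_rat_btwn.1 hc
        refine lt_of_le_of_lt (iInf_le _ q) ?_
        rw [if_pos ((hω q).1 (le_of_lt (by exact_mod_cast hq1)))]
        exact hq2
      · refine le_iInf fun q => ?_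
        split_ifs with h
        · exact EReal.coe_le_coe_iff.2 ((hω q).2 h)
        · exact le_top
    rw [this, EReal.toReal_coe]
  have hr'm : Measurable[pointSigma Φ] fun ω => (g ω).toReal :=
    measurable_ereal_toReal.comp hg
  have hr'm' : Measurable fun ω => (g ω).toReal := hr'm.mono hle le_rfl
  refine ⟨fun ω => (g ω).toReal, hr'm, hrg, ?_⟩
  have := Measure.isProbabilityMeasure_map (μ := P) hr'm'.aemeasurable
  have := Measure.isProbabilityMeasure_map (μ := firstPointLaw Λ G τ) hd.aemeasurable
  -- The cover bound gives one inequality for every Borel set; equal total masses turn it into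
  -- equality.
  refine Measure.eq_of_le_of_isProbabilityMeasure (Measure.le_iff.2 fun s hs => ?_)
  rw [Measure.map_apply hr'm' hs, Measure.map_apply hd hs]
  obtain ⟨V, -, h2, h3⟩ := hcover s hs
  refine le_trans (measure_mono_ae ?_) h3
  filter_upwards [h2, hrg] with ω hω h hmem
  exact hω (by rw [h]; exact hmem)

end FirstPoint

/-! ### The Laplace functional of a Poisson point process -/

section LaplaceFunctional

open Filter Topology

/-- The function `x ↦ exp (-x)` on `[0, ∞]`. -/
noncomputable def expNeg (x : ℝ≥0∞) : ℝ≥0∞ := (EReal.exp (x : EReal))⁻¹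

@[simp]
theorem expNeg_zero : expNeg 0 = 1 := by simp [expNeg]

theorem expNeg_add (x y : ℝ≥0∞) : expNeg (x + y) = expNeg x * expNeg y := by
  rw [expNeg, EReal.coe_ennreal_add, EReal.exp_add, ENNReal.mul_inv]
  · rfl
  · left; simp
  · right; simp

theorem expNeg_sum {ι : Type*} (s : Finset ι) (f : ι → ℝ≥0∞) :
    expNeg (∑ i ∈ s, f i) = ∏ i ∈ s, expNeg (f i) := by
  classical
  induction s using Finset.induction_on with
  | empty => simp
  | insert a s ha ih => rw [Finset.sum_insert ha, Finset.prod_insert ha, expNeg_add, ih]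

theorem expNeg_mul_natCast (x : ℝ≥0∞) (n : ℕ) : expNeg (x * n) = expNeg x ^ n := by
  induction n with
  | zero => simp
  | succ n ih => rw [Nat.cast_succ, mul_add, mul_one, expNeg_add, ih, pow_succ]

theorem expNeg_antitone : Antitone expNeg := fun _ _ hxy =>
  ENNReal.inv_le_inv.2 (EReal.exp_monotone (EReal.coe_ennreal_le_coe_ennreal_iff.2 hxy))

theorem expNeg_le_one (x : ℝ≥0∞) : expNeg x ≤ 1 :=
  (expNeg_antitone zero_le).trans_eq expNeg_zero

theorem continuous_expNeg : Continuous expNeg :=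
  (ENNReal.continuous_exp.comp continuous_coe_ennreal_ereal).inv

theorem expNeg_ofReal {x : ℝ} (hx : 0 ≤ x) :
    expNeg (ENNReal.ofReal x) = ENNReal.ofReal (Real.exp (-x)) := by
  rw [expNeg, EReal.coe_ennreal_ofReal, max_eq_left hx, EReal.exp_coe,
    ← ENNReal.ofReal_inv_of_pos (Real.exp_pos x), Real.exp_neg]

theorem expNeg_top : expNeg ∞ = 0 := by simp [expNeg]

/-- The sum of `f` over the points of `T`. -/
noncomputable def pointSum {X : Type*} (f : X → ℝ≥0∞) (T : Set X) : ℝ≥0∞ := ∑' p : T, f p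

theorem pointSum_simpleFunc {X : Type*} [MeasurableSpace X] (g : SimpleFunc X ℝ≥0∞) (T : Set X) :
    pointSum g T = ∑ c ∈ g.range, c * ((T ∩ g ⁻¹' {c}).encard : ℝ≥0∞) := by
  have h : ∀ x, g x = ∑ c ∈ g.range, (g ⁻¹' {c}).indicator (fun _ => c) x := by
    intro x
    rw [Finset.sum_eq_single_of_mem (g x) (SimpleFunc.mem_range_self g x)]
    · simp
    · intro c _ hc
      simp [Ne.symm hc]
  have hind : ∀ c, ∑' p : T, (g ⁻¹' {c}).indicator (fun _ => c) (p : X)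
      = c * ((T ∩ g ⁻¹' {c}).encard : ℝ≥0∞) := by
    intro c
    rw [tsum_subtype T, Set.indicator_indicator,
      ← tsum_subtype (T ∩ g ⁻¹' {c}) (fun _ => c), ENNReal.tsum_const, mul_comm]
    rfl
  unfold pointSum
  rw [tsum_congr fun p : T => h p, Summable.tsum_finsetSum fun c _ => ENNReal.summable]
  exact Finset.sum_congr rfl fun c _ => hind c

/-- This is monotone convergence for counting measure on `T`; the discrete σ-algebra removes any
countability or measurability condition on `T`. -/
theorem tendsto_pointSum {X : Type*} {g : ℕ → X → ℝ≥0∞} {f : X → ℝ≥0∞} (T : Set X)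
    (hmono : ∀ x, Monotone fun n => g n x)
    (hlim : ∀ x, Tendsto (fun n => g n x) atTop (𝓝 (f x))) :
    Tendsto (fun n => pointSum (g n) T) atTop (𝓝 (pointSum f T)) := by
  let _ : MeasurableSpace T := ⊤
  have h : ∀ u : X → ℝ≥0∞, pointSum u T = ∫⁻ p : T, u p ∂Measure.count := fun u =>
    (lintegral_count' (f := fun p : T => u p) measurable_from_top).symm
  simp only [h]
  exact lintegral_tendsto_of_tendsto_of_monotone (fun n => measurable_from_top.aemeasurable)
    (Eventually.of_forall fun p => hmono p) (Eventually.of_forall fun p => hlim p)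

theorem measurable_pointSum {Ω X : Type*} [MeasurableSpace X] (Φ : Ω → Set X) {f : X → ℝ≥0∞}
    (hf : Measurable f) : Measurable[pointSigma Φ] fun ω => pointSum f (Φ ω) := by
  let _ : MeasurableSpace Ω := pointSigma Φ
  refine measurable_of_tendsto_metrizable (f := fun n ω => pointSum (SimpleFunc.eapprox f n) (Φ ω))
    (fun n => ?_) (tendsto_pi_nhds.2 fun ω => tendsto_pointSum _
      (fun x => fun m n hmn => SimpleFunc.monotone_eapprox f hmn x)
      fun x => SimpleFunc.tendsto_eapprox hf x)
  simp only [pointSum_simpleFunc]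
  refine Finset.measurable_sum _ fun c _ => Measurable.const_mul ?_ _
  exact (measurable_from_top (f := ENat.toENNReal)).comp (measurable_pointCount_pointSigma Φ
    (SimpleFunc.measurableSet_fiber _ c))

variable {Ω X : Type*} [MeasurableSpace Ω] [MeasurableSpace X]
  {Φ : Ω → Set X} {Λ : Measure X} {P : Measure Ω}

/-- This is the Poisson generating function at `q = expNeg c`. The case `c = ∞` is included with `q
= 0` and gives the void probability. -/
theorem lintegral_expNeg_mul_poissonMeasure (r : NNReal) (c : ℝ≥0∞) :
    ∫⁻ n : ℕ, expNeg (c * n) ∂(poissonMeasure r) = expNeg ((1 - expNeg c) * r) := by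
  obtain ⟨q, hq0, hq⟩ : ∃ q : ℝ, 0 ≤ q ∧ expNeg c = ENNReal.ofReal q :=
    ⟨(expNeg c).toReal, ENNReal.toReal_nonneg,
      (ENNReal.ofReal_toReal (ne_top_of_le_ne_top ENNReal.one_ne_top (expNeg_le_one c))).symm⟩
  have hq1 : q ≤ 1 := ENNReal.ofReal_le_one.1 (hq ▸ expNeg_le_one c)
  have hr : (r : ℝ≥0∞) = ENNReal.ofReal r := by simp
  have hs : HasSum (fun n : ℕ => Real.exp (-r) * ((q * r) ^ n / n.factorial))
      (Real.exp (-r) * Real.exp (q * r)) := by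
    refine HasSum.mul_left _ ?_
    have := NormedSpace.expSeries_div_hasSum_exp (𝔸 := ℝ) (q * r)
    rwa [← Real.exp_eq_exp_ℝ] at this
  rw [hq, hr, ← ENNReal.ofReal_one, ← ENNReal.ofReal_sub _ hq0,
    ← ENNReal.ofReal_mul (by linarith), expNeg_ofReal (x := (1 - q) * r) (mul_nonneg (by linarith) r.2),
    lintegral_countable']
  have hterm : ∀ n : ℕ, expNeg (c * n) * poissonMeasure r {n}
      = ENNReal.ofReal (Real.exp (-r) * ((q * r) ^ n / n.factorial)) := by
    intro n
    rw [expNeg_mul_natCast, hq, poissonMeasure_singleton, ← ENNReal.ofReal_pow hq0,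
      ← ENNReal.ofReal_mul (by positivity)]
    congr 1
    rw [mul_pow]
    ring
  rw [tsum_congr hterm, ← ENNReal.ofReal_tsum_of_nonneg _ hs.summable, hs.tsum_eq, ← Real.exp_add]
  · congr 2; ring
  · intro n; positivity

/-- Finiteness is required only for `c ≠ 0`: the zero level set of a simple function may have
infinite intensity, and it contributes nothing. -/
theorem IsPoissonPP.lintegral_expNeg_mul_count [IsProbabilityMeasure P]
    (hΦ : IsPoissonPP Φ Λ P) {B : Set X} (hB : MeasurableSet B) (c : ℝ≥0∞)
    (hc : c ≠ 0 → Λ B ≠ ∞) :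
    ∫⁻ ω, expNeg (c * (pointCount Φ B ω : ℝ≥0∞)) ∂P = expNeg ((1 - expNeg c) * Λ B) := by
  by_cases h0 : c = 0
  · simp [h0]
  have hfin := hc h0
  have h1 : ∫⁻ ω, expNeg (c * (pointCount Φ B ω : ℝ≥0∞)) ∂P =
      ∫⁻ n : ℕ∞, expNeg (c * (n : ℝ≥0∞)) ∂(P.map (pointCount Φ B)) :=
    (lintegral_map (f := fun n : ℕ∞ => expNeg (c * (n : ℝ≥0∞))) measurable_from_top
      (hΦ.measurable_count B hB)).symm
  rw [h1, hΦ.map_pointCount hB hfin, lintegral_map measurable_from_top measurable_from_top]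
  simp only [ENat.toENNReal_coe]
  rw [lintegral_expNeg_mul_poissonMeasure, ENNReal.coe_toNNReal hfin]

theorem IsPoissonPP.lintegral_expNeg_pointSum_simpleFunc [IsProbabilityMeasure P]
    (hΦ : IsPoissonPP Φ Λ P) (g : SimpleFunc X ℝ≥0∞) (hg : ∀ c ≠ 0, Λ (g ⁻¹' {c}) ≠ ∞) :
    ∫⁻ ω, expNeg (pointSum g (Φ ω)) ∂P = expNeg (∫⁻ x, (1 - expNeg (g x)) ∂Λ) := by
  -- The values of `g` are enumerated because `indep_count` is indexed by `Fin n`. Distinct values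
  -- have disjoint fibres, so the exponential of the sum is a product of independent factors.
  let e := g.range.equivFin
  let c : Fin g.range.card → ℝ≥0∞ := fun i => (e.symm i : ℝ≥0∞)
  have hcinj : Function.Injective c := Subtype.val_injective.comp e.symm.injective
  have hsum : ∀ u : ℝ≥0∞ → ℝ≥0∞, ∑ a ∈ g.range, u a = ∑ i, u (c i) := fun u => by
    rw [← Finset.sum_coe_sort g.range]
    exact (Equiv.sum_comp e.symm fun a : g.range => u a).symm
  have hind : iIndepFun (fun i => pointCount Φ (g ⁻¹' {c i})) P := by
    refine hΦ.indep_count _ _ (fun i => g.measurableSet_fiber _) fun i j hij => ?_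
    refine Set.disjoint_left.2 fun x hx hx' => hij (hcinj ?_)
    exact (show g x = c i from hx).symm.trans hx'
  have hind' : iIndepFun
      (fun i ω => expNeg (c i * (pointCount Φ (g ⁻¹' {c i}) ω : ℝ≥0∞))) P :=
    hind.comp (fun i (n : ℕ∞) => expNeg (c i * (n : ℝ≥0∞))) fun i => measurable_from_top
  have h1 : ∀ ω, expNeg (pointSum g (Φ ω))
      = ∏ i, expNeg (c i * (pointCount Φ (g ⁻¹' {c i}) ω : ℝ≥0∞)) := by
    intro ω
    rw [pointSum_simpleFunc, hsum, expNeg_sum]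
    rfl
  have h2 : ∫⁻ x, (1 - expNeg (g x)) ∂Λ
      = ∑ a ∈ g.range, (1 - expNeg a) * Λ (g ⁻¹' {a}) := by
    rw [← SimpleFunc.map_lintegral (fun a => 1 - expNeg a) g, ← SimpleFunc.lintegral_eq_lintegral]
    rfl
  simp only [h1]
  rw [lintegral_prod_eq_prod_lintegral_of_indepFun _ _ hind', h2, hsum, expNeg_sum]
  · exact Finset.prod_congr rfl fun i _ =>
      hΦ.lintegral_expNeg_mul_count (g.measurableSet_fiber _) _ (hg _)
  · intro i
    exact (measurable_from_top (f := fun n : ℕ∞ => expNeg (c i * (n : ℝ≥0∞)))).comp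
      (hΦ.measurable_count _ (g.measurableSet_fiber _))

/-- The Laplace functional of a Poisson point process. -/
theorem IsPoissonPP.lintegral_expNeg_pointSum [IsProbabilityMeasure P] [SigmaFinite Λ]
    (hΦ : IsPoissonPP Φ Λ P) {f : X → ℝ≥0∞} (hf : Measurable f) :
    ∫⁻ ω, expNeg (pointSum f (Φ ω)) ∂P = expNeg (∫⁻ x, (1 - expNeg (f x)) ∂Λ) := by
  -- Cutting the simple approximations off outside the spanning sets keeps them increasing to `f`
  -- and gives every nonzero level set finite intensity.
  let g : ℕ → SimpleFunc X ℝ≥0∞ := fun n =>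
    (SimpleFunc.eapprox f n).restrict (spanningSets Λ n)
  have hgx : ∀ n x, g n x = (spanningSets Λ n).indicator (SimpleFunc.eapprox f n) x := fun n x => by
    simp only [g]
    rw [SimpleFunc.restrict_apply _ (measurableSet_spanningSets Λ n)]
  have hmono : ∀ x, Monotone fun n => g n x := by
    intro x m n hmn
    simp only [hgx]
    refine Set.indicator_le_indicator_of_subset (monotone_spanningSets Λ hmn) (fun _ => zero_le) x
      |>.trans ?_
    exact Set.indicator_le_indicator (SimpleFunc.monotone_eapprox f hmn x)
  have hlim : ∀ x, Tendsto (fun n => g n x) atTop (𝓝 (f x)) := by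
    intro x
    refine (SimpleFunc.tendsto_eapprox hf x).congr' ?_
    filter_upwards [eventually_ge_atTop (spanningSetsIndex Λ x)] with n hn
    rw [hgx, Set.indicator_of_mem]
    exact mem_spanningSets_of_index_le Λ x hn
  have hg : ∀ n, ∀ c ≠ 0, Λ (g n ⁻¹' {c}) ≠ ∞ := by
    intro n c hc
    refine ne_top_of_le_ne_top (measure_spanningSets_lt_top Λ n).ne (measure_mono fun x hx => ?_)
    by_contra hxn
    refine hc ?_
    rw [← (show g n x = c from hx), hgx, Set.indicator_of_notMem hxn]
  have hL : Tendsto (fun n => ∫⁻ ω, expNeg (pointSum (g n) (Φ ω)) ∂P) atTop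
      (𝓝 (∫⁻ ω, expNeg (pointSum f (Φ ω)) ∂P)) := by
    refine tendsto_lintegral_of_dominated_convergence (fun _ => 1) (fun n => ?_) (fun n => ?_)
      (by simp) ?_
    · exact continuous_expNeg.measurable.comp
        ((measurable_pointSum Φ (g n).measurable).mono hΦ.pointSigma_le le_rfl)
    · exact Eventually.of_forall fun ω => expNeg_le_one _
    · exact Eventually.of_forall fun ω =>
        (continuous_expNeg.tendsto _).comp (tendsto_pointSum _ hmono hlim)
  have hsub : Continuous fun x : ℝ≥0∞ => 1 - expNeg x :=
    (ENNReal.continuous_sub_left ENNReal.one_ne_top).comp continuous_expNeg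
  have hR : Tendsto (fun n => ∫⁻ x, (1 - expNeg (g n x)) ∂Λ) atTop
      (𝓝 (∫⁻ x, (1 - expNeg (f x)) ∂Λ)) := by
    refine lintegral_tendsto_of_tendsto_of_monotone (fun n => ?_) ?_ ?_
    · exact (hsub.measurable.comp (g n).measurable).aemeasurable
    · exact Eventually.of_forall fun x m n hmn =>
        tsub_le_tsub_left (expNeg_antitone (hmono x hmn)) 1
    · exact Eventually.of_forall fun x => (hsub.tendsto _).comp (hlim x)
  refine tendsto_nhds_unique hL (((continuous_expNeg.tendsto _).comp hR).congr fun n => ?_)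
  exact (hΦ.lintegral_expNeg_pointSum_simpleFunc (g n) (hg n)).symm

end LaplaceFunctional

/-! ### Exponential and radial integrals -/

section Integrals

open Filter Topology Set

theorem setLIntegral_Ioi_of_hasDerivAt {g g' : ℝ → ℝ} {a l : ℝ}
    (hderiv : ∀ x ∈ Ici a, HasDerivAt g (g' x) x) (hpos : ∀ x ∈ Ioi a, 0 ≤ g' x)
    (hg : Tendsto g atTop (𝓝 l)) :
    ∫⁻ x in Ioi a, ENNReal.ofReal (g' x) = ENNReal.ofReal (l - g a) := by
  rw [← integral_Ioi_of_hasDerivAt_of_nonneg' hderiv hpos hg,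
    ofReal_integral_eq_lintegral_ofReal (integrableOn_Ioi_deriv_of_nonneg' hderiv hpos hg)
      ((ae_restrict_iff' measurableSet_Ioi).2 (Eventually.of_forall hpos))]

theorem setLIntegral_Ioi_exp {c : ℝ} (hc : 0 < c) (a : ℝ) :
    ∫⁻ x in Ioi a, ENNReal.ofReal (c * Real.exp (-(c * x)))
      = ENNReal.ofReal (Real.exp (-(c * a))) := by
  have h : Tendsto (fun x : ℝ => -Real.exp (-(c * x))) atTop (𝓝 (-0)) :=
    (Real.tendsto_exp_neg_atTop_nhds_zero.comp (tendsto_id.const_mul_atTop hc)).neg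
  rw [setLIntegral_Ioi_of_hasDerivAt (fun x _ => hasDerivAt_neg_exp_mul_exp)
    (fun x _ => by positivity) h]
  simp

theorem setLIntegral_Ioi_exp' {c : ℝ} (hc : 0 < c) (a : ℝ) :
    ∫⁻ x in Ioi a, ENNReal.ofReal (Real.exp (-(c * x)))
      = ENNReal.ofReal (Real.exp (-(c * a)) / c) := by
  have h := setLIntegral_Ioi_exp hc a
  simp_rw [ENNReal.ofReal_mul hc.le] at h
  rw [lintegral_const_mul _ (by fun_prop)] at h
  rw [ENNReal.ofReal_div_of_pos hc, ← h, ENNReal.mul_div_right_comm,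
    ENNReal.div_self (by simpa using hc) ENNReal.ofReal_ne_top, one_mul]

theorem setLIntegral_Ioc_of_hasDerivAt {g g' : ℝ → ℝ} {a b : ℝ} (hab : a ≤ b)
    (hderiv : ∀ x, HasDerivAt g (g' x) x) (hcont : Continuous g') (hpos : ∀ x ∈ Ioc a b, 0 ≤ g' x) :
    ∫⁻ x in Ioc a b, ENNReal.ofReal (g' x) = ENNReal.ofReal (g b - g a) := by
  rw [← intervalIntegral.integral_eq_sub_of_hasDerivAt (fun x _ => hderiv x)
      (hcont.intervalIntegrable a b), intervalIntegral.integral_of_le hab,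
    ofReal_integral_eq_lintegral_ofReal (hcont.integrableOn_Ioc)
      ((ae_restrict_iff' measurableSet_Ioc).2 (Eventually.of_forall hpos))]

theorem setLIntegral_Ioc_exp {c : ℝ} (hc : 0 < c) {a b : ℝ} (hab : a ≤ b) :
    ∫⁻ x in Ioc a b, ENNReal.ofReal (Real.exp (-(c * x)))
      = ENNReal.ofReal ((Real.exp (-(c * a)) - Real.exp (-(c * b))) / c) := by
  rw [setLIntegral_Ioc_of_hasDerivAt (g := fun x => -Real.exp (-(c * x)) / c) hab
    (fun x => ?_) (by fun_prop) fun x _ => (Real.exp_pos _).le]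
  · congr 1; ring
  · convert! (hasDerivAt_neg_exp_mul_exp (r := c) (x := x)).div_const c using 1
    field_simp

/-- The two densities differ at most at the null point `0`; the open half-line reflects that
exponential waiting times are almost surely positive. -/
theorem expMeasure_eq_withDensity (r : ℝ) :
    expMeasure r = (volume.restrict (Ioi 0)).withDensity
      fun x => ENNReal.ofReal (r * Real.exp (-(r * x))) := by
  rw [← withDensity_indicator measurableSet_Ioi]
  change volume.withDensity (exponentialPDF r) = _
  refine withDensity_congr_ae ?_
  filter_upwards [compl_mem_ae_iff.2 (measure_singleton (μ := volume) (0 : ℝ))] with x hx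
  rcases lt_or_gt_of_ne (show x ≠ 0 from hx) with h | h
  · rw [exponentialPDF_of_neg h, indicator_of_notMem]
    exact not_lt.2 h.le
  · rw [exponentialPDF_of_nonneg h.le, indicator_of_mem (show x ∈ Ioi 0 from h)]

theorem lintegral_expMeasure {r : ℝ} {f : ℝ → ℝ≥0∞} (hf : Measurable f) :
    ∫⁻ x, f x ∂(expMeasure r)
      = ∫⁻ x in Ioi 0, ENNReal.ofReal (r * Real.exp (-(r * x))) * f x := by
  rw [expMeasure_eq_withDensity, lintegral_withDensity_eq_lintegral_mul _ (by fun_prop) hf]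
  rfl

theorem expMeasure_Iic_zero (r : ℝ) : expMeasure r (Iic 0) = 0 := by
  rw [expMeasure_eq_withDensity, withDensity_apply _ measurableSet_Iic,
    Measure.restrict_restrict measurableSet_Iic,
    (Set.disjoint_left.2 fun x (hx : x ≤ 0) (hx' : 0 < x) => not_lt.2 hx hx' :
      Disjoint (Iic (0 : ℝ)) (Ioi 0)).inter_eq,
    Measure.restrict_empty, lintegral_zero_measure]

theorem expMeasure_Ioi {r : ℝ} (hr : 0 < r) {x : ℝ} (hx : 0 ≤ x) :
    expMeasure r (Ioi x) = ENNReal.ofReal (Real.exp (-(r * x))) := by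
  rw [expMeasure_eq_withDensity, withDensity_apply _ measurableSet_Ioi,
    Measure.restrict_restrict measurableSet_Ioi, Ioi_inter_Ioi, max_eq_left hx,
    setLIntegral_Ioi_exp hr]

/-- Here the exponential law of the serving gain turns a coverage probability into a Laplace
transform. Allowing `y = ∞` covers infinite interference without a separate argument. -/
theorem expMeasure_ofReal_gt {r : ℝ} (hr : 0 < r) (y : ℝ≥0∞) :
    expMeasure r {x | y < ENNReal.ofReal x} = expNeg (ENNReal.ofReal r * y) := by
  by_cases hy : y = ∞
  · subst hy
    rw [ENNReal.mul_top (by simpa using hr), expNeg_top]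
    simp
  · lift y to NNReal using hy
    have h : {x : ℝ | (y : ℝ≥0∞) < ENNReal.ofReal x} = Ioi (y : ℝ) := by
      ext x
      rw [← ENNReal.ofReal_coe_nnreal]
      exact ENNReal.ofReal_lt_ofReal_iff_of_nonneg y.2
    rw [h, expMeasure_Ioi hr y.coe_nonneg, ← ENNReal.ofReal_coe_nnreal, ← ENNReal.ofReal_mul hr.le,
      expNeg_ofReal (by positivity)]

/-- The Laplace transform of an interferer's gain at `r * t` is `1 / (1 + t)`; the rate `r` cancels,
which is why `ζ` is absent from the final formula. -/
theorem lintegral_expMeasure_expNeg {r : ℝ} (hr : 0 < r) {t : ℝ} (ht : 0 ≤ t) :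
    ∫⁻ x, (1 - expNeg (ENNReal.ofReal (r * t * x))) ∂(expMeasure r)
      = ENNReal.ofReal (t / (1 + t)) := by
  have hm : Measurable fun x : ℝ => expNeg (ENNReal.ofReal (r * t * x)) :=
    continuous_expNeg.measurable.comp (by fun_prop)
  have := isProbabilityMeasure_expMeasure hr
  have h1 : ∫⁻ x, expNeg (ENNReal.ofReal (r * t * x)) ∂(expMeasure r)
      = ENNReal.ofReal (1 / (1 + t)) := by
    rw [lintegral_expMeasure hm]
    have hpos : 0 < r * (1 + t) := by positivity
    have h2 : ∀ x ∈ Ioi (0 : ℝ), ENNReal.ofReal (r * Real.exp (-(r * x)))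
        * expNeg (ENNReal.ofReal (r * t * x))
        = ENNReal.ofReal r * ENNReal.ofReal (Real.exp (-(r * (1 + t) * x))) := by
      intro x hx
      have hx0 : 0 ≤ x := le_of_lt hx
      rw [expNeg_ofReal (by positivity), ← ENNReal.ofReal_mul (by positivity),
        ← ENNReal.ofReal_mul hr.le, mul_assoc, ← Real.exp_add]
      congr 3; ring
    rw [setLIntegral_congr_fun measurableSet_Ioi h2, lintegral_const_mul _ (by fun_prop),
      setLIntegral_Ioi_exp' hpos, ← ENNReal.ofReal_mul hr.le]
    congr 1
    simp only [mul_zero, neg_zero, Real.exp_zero]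
    field_simp
  rw [lintegral_sub hm (by rw [h1]; exact ENNReal.ofReal_ne_top)
    (Eventually.of_forall fun x => expNeg_le_one _), h1, lintegral_one, measure_univ,
    ← ENNReal.ofReal_one, ← ENNReal.ofReal_sub _ (by positivity)]
  congr 1
  field_simp
  ring

theorem volume_plane_area_le (a : ℝ) :
    volume {x : Plane | Real.pi * ‖x‖ ^ 2 ≤ a} = ENNReal.ofReal a := by
  by_cases ha : 0 ≤ a
  · have h : {x : Plane | Real.pi * ‖x‖ ^ 2 ≤ a} = Metric.closedBall 0 (√(a / Real.pi)) := by
      ext x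
      rw [mem_ofPred_eq, mem_closedBall_zero_iff, Real.le_sqrt (norm_nonneg x) (by positivity),
        le_div_iff₀ Real.pi_pos, mul_comm]
    rw [h, EuclideanSpace.volume_closedBall_fin_two, ← ENNReal.ofReal_pow (Real.sqrt_nonneg _),
      Real.sq_sqrt (by positivity), ← ENNReal.ofReal_mul (by positivity)]
    congr 1
    field_simp
  · rw [ENNReal.ofReal_of_nonpos (not_le.1 ha).le]
    convert! measure_empty (μ := (volume : Measure Plane))
    ext x
    simp only [mem_ofPred_eq, mem_empty_iff_false, iff_false, not_le]
    exact lt_of_lt_of_le (not_le.1 ha) (by positivity)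

/-- The image of planar Lebesgue measure under the area of the centred disc through a point. -/
theorem map_plane_area :
    (volume : Measure Plane).map (fun x => Real.pi * ‖x‖ ^ 2) = volume.restrict (Ioi (0 : ℝ)) := by
  have hm : Measurable fun x : Plane => Real.pi * ‖x‖ ^ 2 := by fun_prop
  symm
  refine Measure.ext_of_Ioc' _ _ (fun a b _ => ?_) fun a b hab => ?_
  · exact ne_top_of_le_ne_top (measure_Ioc_lt_top (μ := volume) (a := a) (b := b)).ne
      (Measure.restrict_apply_le _ _)
  · rw [Measure.map_apply hm measurableSet_Ioc, Measure.restrict_apply measurableSet_Ioc,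
      Ioc_inter_Ioi, Real.volume_Ioc]
    have h : (fun x : Plane => Real.pi * ‖x‖ ^ 2) ⁻¹' Ioc a b
        = {x | Real.pi * ‖x‖ ^ 2 ≤ b} \ {x | Real.pi * ‖x‖ ^ 2 ≤ a} := by
      ext x; simp [and_comm]
    rw [h, measure_sdiff (show {x : Plane | Real.pi * ‖x‖ ^ 2 ≤ a} ⊆ {x | Real.pi * ‖x‖ ^ 2 ≤ b} from
        fun x hx => le_trans hx hab.le)
      (measurableSet_le hm measurable_const).nullMeasurableSet
      (by rw [volume_plane_area_le]; exact ENNReal.ofReal_ne_top),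
      volume_plane_area_le, volume_plane_area_le]
    rcases le_total 0 a with ha | ha
    · rw [max_eq_left ha, ENNReal.ofReal_sub _ ha]
    · rw [max_eq_right ha, sub_zero, ENNReal.ofReal_of_nonpos ha, tsub_zero]

theorem lintegral_plane_area {f : ℝ → ℝ≥0∞} (hf : Measurable f) :
    ∫⁻ x : Plane, f (Real.pi * ‖x‖ ^ 2) = ∫⁻ u in Ioi (0 : ℝ), f u := by
  rw [← map_plane_area, lintegral_map hf (by fun_prop)]

theorem lintegral_div_sq_add_sq {b : ℝ} (hb : 0 < b) :
    ∫⁻ u in Ioi (0 : ℝ), ENNReal.ofReal (b ^ 2 / (u ^ 2 + b ^ 2))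
      = ENNReal.ofReal (b * (Real.pi / 2)) := by
  have hd : ∀ u : ℝ, HasDerivAt (fun u => b * Real.arctan (u / b)) (b ^ 2 / (u ^ 2 + b ^ 2)) u := by
    intro u
    convert! (((hasDerivAt_id u).div_const b).arctan).const_mul b using 1
    simp only [id]
    field_simp
    ring
  have hl : Tendsto (fun u : ℝ => b * Real.arctan (u / b)) atTop (𝓝 (b * (Real.pi / 2))) :=
    ((Real.tendsto_arctan_atTop.mono_right nhdsWithin_le_nhds).comp
      (tendsto_id.atTop_div_const hb)).const_mul b
  rw [setLIntegral_Ioi_of_hasDerivAt (fun u _ => hd u) (fun u _ => by positivity) hl]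
  simp

end Integrals

/-! ### Interference -/

section Interference

open Set

theorem sigmaFinite_interfererIntensity (ρ pA : ℝ) {ζ : ℝ} (hζ : 0 < ζ) :
    SigmaFinite (interfererIntensity ρ pA ζ) := by
  have := isProbabilityMeasure_expMeasure hζ
  unfold interfererIntensity
  have : SigmaFinite (ENNReal.ofReal (pA * ρ) • (volume : Measure Plane)) :=
    inferInstanceAs (SigmaFinite ((pA * ρ).toNNReal • (volume : Measure Plane)))
  infer_instance

/-- After averaging over the gain, the integrand depends on `x` only through `u = π ‖x‖ ^ 2`.
Path-loss exponent four makes it `b ^ 2 / (u ^ 2 + b ^ 2)` with `b = √γ * π * r ^ 2`, whose integral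
is `b * π / 2`. -/
theorem lintegral_interfererIntensity {ρ pA ζ γ r : ℝ} (hρ : 0 < ρ) (hpA : 0 < pA) (hζ : 0 < ζ)
    (hγ : 0 < γ) (hr : 0 < r) :
    ∫⁻ p, (1 - expNeg (ENNReal.ofReal (ζ * (γ * r ^ 4 * ‖p.1‖ ^ (-4 : ℝ)) * p.2)))
      ∂(interfererIntensity ρ pA ζ)
      = ENNReal.ofReal (pA * √γ * Real.pi / 2 * (ρ * (Real.pi * r ^ 2))) := by
  have := isProbabilityMeasure_expMeasure hζ
  have hsub : Continuous fun x : ℝ≥0∞ => 1 - expNeg x :=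
    (ENNReal.continuous_sub_left ENNReal.one_ne_top).comp continuous_expNeg
  set b : ℝ := √γ * r ^ 2 * Real.pi with hb
  have hbpos : 0 < b := by positivity
  have hb2 : b ^ 2 = γ * r ^ 4 * Real.pi ^ 2 := by
    rw [hb, mul_pow, mul_pow, Real.sq_sqrt hγ.le]; ring
  have hinner : ∀ x : Plane,
      ∫⁻ g, (1 - expNeg (ENNReal.ofReal (ζ * (γ * r ^ 4 * ‖x‖ ^ (-4 : ℝ)) * g))) ∂(expMeasure ζ)
      = ENNReal.ofReal ((γ * r ^ 4 * ‖x‖ ^ (-4 : ℝ)) / (1 + γ * r ^ 4 * ‖x‖ ^ (-4 : ℝ))) :=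
    fun x => lintegral_expMeasure_expNeg hζ (by positivity)
  have hradial : ∀ x : Plane, x ≠ 0 →
      (γ * r ^ 4 * ‖x‖ ^ (-4 : ℝ)) / (1 + γ * r ^ 4 * ‖x‖ ^ (-4 : ℝ))
      = b ^ 2 / ((Real.pi * ‖x‖ ^ 2) ^ 2 + b ^ 2) := by
    intro x hx
    have hx' : 0 < ‖x‖ := norm_pos_iff.2 hx
    rw [hb2, Real.rpow_neg hx'.le, show (4 : ℝ) = ((4 : ℕ) : ℝ) by norm_num, Real.rpow_natCast]
    field_simp
  unfold interfererIntensity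
  have hmeas : Measurable fun p : Plane × ℝ =>
      1 - expNeg (ENNReal.ofReal (ζ * (γ * r ^ 4 * ‖p.1‖ ^ (-4 : ℝ)) * p.2)) :=
    hsub.measurable.comp (by fun_prop)
  rw [lintegral_prod _ hmeas.aemeasurable]
  simp only [hinner]
  rw [lintegral_smul_measure]
  -- The origin must be excluded: there `‖x‖ ^ (-4)` takes the default value `0`.
  have hae : ∀ᵐ x : Plane, ENNReal.ofReal
      ((γ * r ^ 4 * ‖x‖ ^ (-4 : ℝ)) / (1 + γ * r ^ 4 * ‖x‖ ^ (-4 : ℝ)))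
      = ENNReal.ofReal (b ^ 2 / ((Real.pi * ‖x‖ ^ 2) ^ 2 + b ^ 2)) := by
    filter_upwards [compl_mem_ae_iff.2 (measure_singleton (μ := volume) (0 : Plane))] with x hx
    rw [hradial x hx]
  rw [lintegral_congr_ae hae, lintegral_plane_area
    (f := fun u => ENNReal.ofReal (b ^ 2 / (u ^ 2 + b ^ 2))) (by fun_prop),
    lintegral_div_sq_add_sq hbpos, smul_eq_mul, ← ENNReal.ofReal_mul (by positivity)]
  congr 1
  rw [hb]; ring

theorem lintegral_expNeg_interferencePower {Ω : Type*} [MeasurableSpace Ω] {P : Measure Ω}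
    [IsProbabilityMeasure P] {ρ pA ζ Ptx γ r : ℝ} {Ψ : Ω → Set (Plane × ℝ)}
    (hΨ : IsPoissonPP Ψ (interfererIntensity ρ pA ζ) P) (hρ : 0 < ρ) (hpA : 0 < pA) (hζ : 0 < ζ)
    (hPtx : 0 < Ptx) (hγ : 0 < γ) (hr : 0 < r) :
    ∫⁻ ω, expNeg (ENNReal.ofReal ζ * (ENNReal.ofReal (γ * r ^ 4 / Ptx)
        * interferencePower Ptx 4 (Ψ ω))) ∂P
      = ENNReal.ofReal (Real.exp (-(pA * √γ * Real.pi / 2 * (ρ * (Real.pi * r ^ 2))))) := by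
  have := sigmaFinite_interfererIntensity ρ pA hζ
  have h : ∀ ω, ENNReal.ofReal ζ * (ENNReal.ofReal (γ * r ^ 4 / Ptx)
        * interferencePower Ptx 4 (Ψ ω))
      = pointSum (fun p => ENNReal.ofReal (ζ * (γ * r ^ 4 * ‖p.1‖ ^ (-4 : ℝ)) * p.2)) (Ψ ω) := by
    intro ω
    rw [interferencePower, pointSum, ← mul_assoc, ← ENNReal.tsum_mul_left]
    refine tsum_congr fun p => ?_
    rw [← ENNReal.ofReal_mul hζ.le, ← ENNReal.ofReal_mul (by positivity)]
    congr 1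
    field_simp
  simp only [h]
  rw [hΨ.lintegral_expNeg_pointSum (by fun_prop),
    lintegral_interfererIntensity hρ hpA hζ hγ hr, expNeg_ofReal (by positivity)]

theorem measurable_interferencePower {Ω : Type*} (Ptx α : ℝ) (Ψ : Ω → Set (Plane × ℝ)) :
    Measurable[pointSigma Ψ] fun ω => interferencePower Ptx α (Ψ ω) :=
  measurable_pointSum Ψ (f := fun p => ENNReal.ofReal (Ptx * p.2 * ‖p.1‖ ^ (-α))) (by fun_prop)

end Interference

/-! ### The serving cell as the cell of lowest score -/

section Serving

open Set

/-- The cells that may serve the user: the idle ones, and those within the threshold distance `R`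
that become available within the tolerable delay `w`. -/
def servingCandidates (R w : ℝ) : Set Cell :=
  {c | c.mode = Mode.idle} ∪
    {c | c.mode ≠ Mode.idle ∧ (0 < c.wait ∧ c.wait ≤ w) ∧ ‖c.loc‖ ≤ R}

open scoped Classical in
/-- A score on cells such that the serving cell is the candidate with the lowest score. -/
noncomputable def cellScore (R w : ℝ) (c : Cell) : ℝ :=
  if c.mode = Mode.idle then (if ‖c.loc‖ ≤ R then ‖c.loc‖ else w + ‖c.loc‖) else R + c.wait

/-- The scores lie in three successive bands: up to `R` for idle cells within the threshold, from
`R` to `R + w` for delayed cells, beyond `R + w` for far idle cells. The order of the bands is the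
priority of the access rules, and within a band the score ranks as its rule does. Positivity of the
waiting times keeps the first two bands apart. -/
theorem isServing_iff_isFirstPoint {S : Set Cell} {R w : ℝ} (hw : 0 ≤ w)
    (hS : ∀ c ∈ S, c.mode ≠ Mode.idle → 0 < c.wait) (b : Cell) :
    IsServing S R w b ↔ IsFirstPoint S (servingCandidates R w) (cellScore R w) b := by
  have hcand : ∀ c ∈ S, c ∈ servingCandidates R w ↔
      c.mode = Mode.idle ∨ (c.mode ≠ Mode.idle ∧ c.wait ≤ w ∧ ‖c.loc‖ ≤ R) := by
    intro c hc
    constructor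
    · rintro (h | h)
      · exact Or.inl h
      · exact Or.inr ⟨h.1, h.2.1.2, h.2.2⟩
    · rintro (h | h)
      · exact Or.inl h
      · exact Or.inr ⟨h.1, ⟨hS c hc h.1, h.2.1⟩, h.2.2⟩
  constructor
  · rintro (⟨hb, hi, hR, hmin⟩ | ⟨hno, hb, hR, hbw, hmin⟩ | ⟨hno, hb, hi, hR, hmin⟩)
    · refine ⟨hb, Or.inl hi, fun c hc hcG => ?_⟩
      have h1 := (hcand c hc).1 hcG
      have h2 := hmin c hc
      have h3 := hS c hc
      simp only [cellScore, hi, hR, if_true]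
      split_ifs with h4 h5
      · exact h2 h4
      · linarith [h2 h4]
      · linarith [h3 h4]
    · have hbi := hno b hb hR
      refine ⟨hb, (hcand b hb).2 (Or.inr ⟨hbi, hbw, hR⟩), fun c hc hcG => ?_⟩
      simp only [cellScore, hbi, if_false]
      split_ifs with h4 h5
      · exact absurd h4 (hno c hc h5)
      · linarith
      · rcases (hcand c hc).1 hcG with h | h
        · exact absurd h h4
        · linarith [hmin c hc h.2.2]
    · refine ⟨hb, Or.inl hi, fun c hc hcG => ?_⟩
      simp only [cellScore, hi, not_le.2 hR, if_true, if_false]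
      split_ifs with h4 h5
      · exact absurd h4 (hno c hc h5).1
      · linarith [hmin c hc h4]
      · rcases (hcand c hc).1 hcG with h | h
        · exact absurd h h4
        · linarith [(hno c hc h.2.2).2]
  · rintro ⟨hb, hbG, hmin⟩
    have hmin' : ∀ c ∈ S, (c.mode = Mode.idle ∨
        (c.mode ≠ Mode.idle ∧ c.wait ≤ w ∧ ‖c.loc‖ ≤ R)) → cellScore R w b ≤ cellScore R w c :=
      fun c hc h => hmin c hc ((hcand c hc).2 h)
    unfold cellScore at hmin'
    rcases (hcand b hb).1 hbG with hi | ⟨hi, hbw, hR⟩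
    · by_cases hR : ‖b.loc‖ ≤ R
      · refine Or.inl ⟨hb, hi, hR, fun c hc hci => ?_⟩
        have := hmin' c hc (Or.inl hci)
        simp only [hi, hci, hR, if_true] at this
        split_ifs at this with h
        · exact this
        · linarith
      · refine Or.inr (Or.inr ⟨fun c hc hcR => ?_, hb, hi, not_le.1 hR, fun c hc hci => ?_⟩)
        · have hci : c.mode ≠ Mode.idle := fun hci => by
            have := hmin' c hc (Or.inl hci)
            simp only [hi, hci, hR, hcR, if_true, if_false] at this
            linarith
          refine ⟨hci, not_le.1 fun hcw => ?_⟩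
          have := hmin' c hc (Or.inr ⟨hci, hcw, hcR⟩)
          simp only [hi, hci, hR, if_true, if_false] at this
          linarith
        · have := hmin' c hc (Or.inl hci)
          simp only [hi, hci, hR, if_true, if_false] at this
          split_ifs at this with h <;> linarith
    · have hno : ∀ c ∈ S, ‖c.loc‖ ≤ R → c.mode ≠ Mode.idle := fun c hc hcR hci => by
        have := hmin' c hc (Or.inl hci)
        simp only [hi, hci, hcR, if_true, if_false] at this
        linarith [hS b hb hi]
      refine Or.inr (Or.inl ⟨hno, hb, hR, hbw, fun c hc hcR => ?_⟩)
      by_cases hcw : c.wait ≤ w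
      · have := hmin' c hc (Or.inr ⟨hno c hc hcR, hcw, hcR⟩)
        simp only [hi, hno c hc hcR, if_false] at this
        linarith
      · linarith

theorem measurable_cell_loc : Measurable Cell.loc := measurable_fst

theorem measurable_cell_wait : Measurable Cell.wait := measurable_snd.comp measurable_snd

theorem measurableSet_cell_mode (s : Set Mode) : MeasurableSet {c : Cell | c.mode ∈ s} :=
  (measurable_fst.comp measurable_snd : Measurable fun c : Cell => c.2.1)
    (show MeasurableSet s from trivial)

theorem measurableSet_servingCandidates (R w : ℝ) : MeasurableSet (servingCandidates R w) := by
  refine (measurableSet_cell_mode {Mode.idle}).union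
    ((measurableSet_cell_mode {Mode.idle}ᶜ).inter (MeasurableSet.inter (MeasurableSet.inter ?_ ?_) ?_))
  · exact measurableSet_lt measurable_const measurable_cell_wait
  · exact measurableSet_le measurable_cell_wait measurable_const
  · exact measurableSet_le measurable_cell_loc.norm measurable_const

theorem measurable_cellScore (R w : ℝ) : Measurable (cellScore R w) := by
  refine Measurable.ite (measurableSet_cell_mode {Mode.idle}) (Measurable.ite ?_ ?_ ?_) ?_
  · exact measurableSet_le measurable_cell_loc.norm measurable_const
  · exact measurable_cell_loc.norm
  · exact measurable_cell_loc.norm.const_add w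
  · exact measurable_cell_wait.const_add R

theorem cellScore_nonneg {R w : ℝ} (hR : 0 < R) (hw : 0 ≤ w) :
    ∀ c ∈ servingCandidates R w, 0 ≤ cellScore R w c := by
  rintro c (h | h)
  · have h' : c.mode = Mode.idle := h
    simp only [cellScore, h', if_true]
    split_ifs <;> positivity
  · have h1 := h.1
    simp only [cellScore, h1, if_false]
    linarith [h.2.1.1]

end Serving

/-! ### The intensity of cells -/

section CellIntensity

open Set

theorem expMeasure_Ioc {r t : ℝ} (hr : 0 < r) (ht : 0 ≤ t) :
    expMeasure r (Ioc 0 t) = ENNReal.ofReal (1 - Real.exp (-(r * t))) := by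
  rw [expMeasure_eq_withDensity, withDensity_apply _ measurableSet_Ioc,
    Measure.restrict_restrict measurableSet_Ioc, inter_eq_left.2 Ioc_subset_Ioi_self,
    setLIntegral_Ioc_of_hasDerivAt ht (fun x => hasDerivAt_neg_exp_mul_exp) (by fun_prop)
      fun x _ => by positivity]
  congr 1
  simp only [mul_zero, neg_zero, Real.exp_zero]
  ring

theorem expMeasure_Ioo {r t : ℝ} (hr : 0 < r) (ht : 0 ≤ t) :
    expMeasure r (Ioo 0 t) = ENNReal.ofReal (1 - Real.exp (-(r * t))) := by
  rw [← expMeasure_Ioc hr ht]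
  refine measure_congr ?_
  have : expMeasure r ≪ volume := withDensity_absolutelyContinuous _ _
  exact this.ae_le Ioo_ae_eq_Ioc

variable {ρ pI pA pS μ lamS : ℝ}

theorem lintegral_modeWaitLaw (hμ : 0 < μ) (hlamS : 0 < lamS) {f : Mode × ℝ → ℝ≥0∞}
    (hf : Measurable f) :
    ∫⁻ m, f m ∂(modeWaitLaw pI pA pS μ lamS) = ENNReal.ofReal pI * f (Mode.idle, 0)
      + ENNReal.ofReal pA * ∫⁻ t, f (Mode.active, t) ∂(expMeasure μ)
      + ENNReal.ofReal pS * ∫⁻ t, f (Mode.sleep, t) ∂(expMeasure lamS) := by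
  have := isProbabilityMeasure_expMeasure hμ
  have := isProbabilityMeasure_expMeasure hlamS
  have h : ∀ (m : Mode) (r : ℝ) [SFinite (expMeasure r)],
      ∫⁻ p, f p ∂((Measure.dirac m).prod (expMeasure r)) = ∫⁻ t, f (m, t) ∂(expMeasure r) := by
    intro m r _
    rw [lintegral_prod _ hf.aemeasurable, lintegral_dirac' _ hf.lintegral_prod_right']
  rw [modeWaitLaw, lintegral_add_measure, lintegral_add_measure, lintegral_smul_measure,
    lintegral_smul_measure, lintegral_smul_measure, lintegral_dirac' _ hf, h, h]
  rfl

theorem modeWaitLaw_idle (hμ : 0 < μ) (hlamS : 0 < lamS) :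
    modeWaitLaw pI pA pS μ lamS ({Mode.idle} ×ˢ univ) = ENNReal.ofReal pI := by
  have hm : MeasurableSet (({Mode.idle} : Set Mode) ×ˢ (univ : Set ℝ)) :=
    MeasurableSet.prod trivial MeasurableSet.univ
  rw [← lintegral_indicator_one hm, lintegral_modeWaitLaw hμ hlamS (measurable_one.indicator hm)]
  simp [indicator]

theorem modeWaitLaw_not_idle (hμ : 0 < μ) (hlamS : 0 < lamS) {J : Set ℝ} (hJ : MeasurableSet J) :
    modeWaitLaw pI pA pS μ lamS ({Mode.idle}ᶜ ×ˢ J)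
      = ENNReal.ofReal pA * expMeasure μ J + ENNReal.ofReal pS * expMeasure lamS J := by
  have hm : MeasurableSet (({Mode.idle}ᶜ : Set Mode) ×ˢ J) := MeasurableSet.prod trivial hJ
  rw [← lintegral_indicator_one hm, lintegral_modeWaitLaw hμ hlamS (measurable_one.indicator hm),
    ← lintegral_indicator_one hJ, ← lintegral_indicator_one hJ]
  have hne : ∀ m ≠ Mode.idle, ∀ t, (({Mode.idle}ᶜ : Set Mode) ×ˢ J).indicator
      (1 : Mode × ℝ → ℝ≥0∞) (m, t) = J.indicator 1 t := by
    intro m hm t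
    by_cases ht : t ∈ J
    · rw [indicator_of_mem ht, indicator_of_mem (mk_mem_prod hm ht)]; rfl
    · rw [indicator_of_notMem ht, indicator_of_notMem fun h => ht h.2]
  have h0 : (({Mode.idle}ᶜ : Set Mode) ×ˢ J).indicator
      (1 : Mode × ℝ → ℝ≥0∞) (Mode.idle, 0) = 0 := indicator_of_notMem (fun h => h.1 rfl) _
  simp only [hne Mode.active (by simp), hne Mode.sleep (by simp), h0, mul_zero, zero_add]

theorem isFiniteMeasure_modeWaitLaw (hμ : 0 < μ) (hlamS : 0 < lamS) :
    IsFiniteMeasure (modeWaitLaw pI pA pS μ lamS) := by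
  have := isProbabilityMeasure_expMeasure hμ
  have := isProbabilityMeasure_expMeasure hlamS
  refine ⟨?_⟩
  rw [← lintegral_one, lintegral_modeWaitLaw hμ hlamS (f := fun _ => 1) measurable_const]
  simp

theorem lintegral_cellIntensity (hμ : 0 < μ) (hlamS : 0 < lamS) {f : Cell → ℝ≥0∞}
    (hf : Measurable f) :
    ∫⁻ c, f c ∂(cellIntensity ρ pI pA pS μ lamS) = ENNReal.ofReal ρ * ∫⁻ x : Plane,
      (ENNReal.ofReal pI * f (x, Mode.idle, 0)
      + ENNReal.ofReal pA * ∫⁻ t, f (x, Mode.active, t) ∂(expMeasure μ)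
      + ENNReal.ofReal pS * ∫⁻ t, f (x, Mode.sleep, t) ∂(expMeasure lamS)) := by
  have := isFiniteMeasure_modeWaitLaw (pI := pI) (pA := pA) (pS := pS) hμ hlamS
  rw [cellIntensity, lintegral_prod _ hf.aemeasurable, lintegral_smul_measure, smul_eq_mul]
  congr 1
  refine lintegral_congr fun x => ?_
  exact lintegral_modeWaitLaw hμ hlamS (hf.comp measurable_prodMk_left)

theorem cellIntensity_prod (hμ : 0 < μ) (hlamS : 0 < lamS) (A : Set Plane) (B : Set (Mode × ℝ)) :
    cellIntensity ρ pI pA pS μ lamS (A ×ˢ B)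
      = ENNReal.ofReal ρ * volume A * modeWaitLaw pI pA pS μ lamS B := by
  have := isFiniteMeasure_modeWaitLaw (pI := pI) (pA := pA) (pS := pS) hμ hlamS
  rw [cellIntensity, Measure.prod_prod]
  rfl

theorem volume_plane_norm_le {s : ℝ} (hs : 0 ≤ s) :
    volume {x : Plane | ‖x‖ ≤ s} = ENNReal.ofReal (Real.pi * s ^ 2) := by
  have h : {x : Plane | ‖x‖ ≤ s} = Metric.closedBall 0 s := by ext x; simp
  rw [h, EuclideanSpace.volume_closedBall_fin_two, ← ENNReal.ofReal_pow hs,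
    ← ENNReal.ofReal_mul (by positivity), mul_comm]

theorem volume_plane_norm_lt {s : ℝ} (hs : 0 ≤ s) :
    volume {x : Plane | ‖x‖ < s} = ENNReal.ofReal (Real.pi * s ^ 2) := by
  have h : {x : Plane | ‖x‖ < s} = Metric.ball 0 s := by ext x; simp
  rw [h, EuclideanSpace.volume_ball_fin_two, ← ENNReal.ofReal_pow hs,
    ← ENNReal.ofReal_mul (by positivity), mul_comm]

theorem cellIntensity_not_idle_wait_nonpos (hμ : 0 < μ) (hlamS : 0 < lamS) :
    cellIntensity ρ pI pA pS μ lamS {c | c.mode ≠ Mode.idle ∧ c.wait ≤ 0} = 0 := by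
  have h : {c : Cell | c.mode ≠ Mode.idle ∧ c.wait ≤ 0} = univ ×ˢ ({Mode.idle}ᶜ ×ˢ Iic 0) := by
    ext c; simp [Cell.mode, Cell.wait]
  rw [h, cellIntensity_prod hμ hlamS, modeWaitLaw_not_idle hμ hlamS measurableSet_Iic,
    expMeasure_Iic_zero, expMeasure_Iic_zero]
  simp

/-- A candidate of score below `s` lies in the disc of radius `max R s`: the delayed ones by the
threshold, the idle ones by their score. -/
theorem cellIntensity_score_lt_ne_top (hμ : 0 < μ) (hlamS : 0 < lamS) {R w : ℝ} (hR : 0 < R)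
    (hw : 0 ≤ w) (s : ℝ) :
    cellIntensity ρ pI pA pS μ lamS
      (servingCandidates R w ∩ {c | cellScore R w c < s}) ≠ ∞ := by
  have := isFiniteMeasure_modeWaitLaw (pI := pI) (pA := pA) (pS := pS) hμ hlamS
  refine ne_top_of_le_ne_top (b := cellIntensity ρ pI pA pS μ lamS
    ({x : Plane | ‖x‖ ≤ max R s} ×ˢ univ)) ?_ (measure_mono ?_)
  · rw [cellIntensity_prod hμ hlamS, volume_plane_norm_le (hR.le.trans (le_max_left R s))]
    exact ENNReal.mul_ne_top (ENNReal.mul_ne_top ENNReal.ofReal_ne_top ENNReal.ofReal_ne_top)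
      (measure_ne_top _ _)
  · rintro c ⟨hc, hs⟩
    refine ⟨?_, trivial⟩
    change ‖c.loc‖ ≤ max R s
    have hs' : cellScore R w c < s := hs
    rcases hc with h | h
    · have h' : c.mode = Mode.idle := h
      simp only [cellScore, h', if_true] at hs'
      split_ifs at hs' with h1
      · exact le_max_of_le_left h1
      · exact le_max_of_le_right (by linarith)
    · exact le_max_of_le_left h.2.2

/-- The intensity of the union of the idle cells near the user and the cells within distance `R`
that are not idle and have a waiting time in `J`. -/
theorem cellIntensity_union (hμ : 0 < μ) (hlamS : 0 < lamS) {A : Set Plane}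
    (R : ℝ) {J : Set ℝ} (hJ : MeasurableSet J) :
    cellIntensity ρ pI pA pS μ lamS
      (A ×ˢ ({Mode.idle} ×ˢ univ) ∪ {x : Plane | ‖x‖ ≤ R} ×ˢ ({Mode.idle}ᶜ ×ˢ J))
      = ENNReal.ofReal ρ * volume A * ENNReal.ofReal pI
        + ENNReal.ofReal ρ * volume {x : Plane | ‖x‖ ≤ R}
          * (ENNReal.ofReal pA * expMeasure μ J + ENNReal.ofReal pS * expMeasure lamS J) := by
  rw [measure_union, cellIntensity_prod hμ hlamS, cellIntensity_prod hμ hlamS,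
    modeWaitLaw_idle hμ hlamS, modeWaitLaw_not_idle hμ hlamS hJ]
  · exact Set.disjoint_left.2 fun c h1 h2 => h2.2.1 h1.2.1
  · exact (measurableSet_le measurable_norm measurable_const).prod
      (MeasurableSet.prod trivial hJ)

variable {R w : ℝ}

theorem scoreTail_near (hρ : 0 < ρ) (hpI : 0 < pI) (hμ : 0 < μ) (hlamS : 0 < lamS) (hw : 0 ≤ w)
    {s : ℝ} (hs : 0 ≤ s) (hsR : s ≤ R) :
    scoreTail (cellIntensity ρ pI pA pS μ lamS) (servingCandidates R w) (cellScore R w) s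
      = ENNReal.ofReal (Real.exp (-(ρ * pI * (Real.pi * s ^ 2)))) := by
  -- No delayed cell scores below `R`; the empty set of waiting times is kept so that
  -- `cellIntensity_union` applies.
  have hset : servingCandidates R w ∩ {c | cellScore R w c < s}
      = {x : Plane | ‖x‖ < s} ×ˢ ({Mode.idle} ×ˢ univ)
        ∪ {x : Plane | ‖x‖ ≤ R} ×ˢ ({Mode.idle}ᶜ ×ˢ ∅) := by
    rw [prod_empty, prod_empty, union_empty]
    ext c
    constructor
    · rintro ⟨h | h, hc⟩
      · have h' : c.mode = Mode.idle := h
        have hc' : cellScore R w c < s := hc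
        simp only [cellScore, h', if_true] at hc'
        refine ⟨?_, h, trivial⟩
        change ‖c.loc‖ < s
        split_ifs at hc' <;> linarith
      · have hc' : cellScore R w c < s := hc
        have h1 := h.1
        simp only [cellScore, h1, if_false] at hc'
        linarith [h.2.1.1]
    · rintro ⟨h1, h2, -⟩
      have h1' : ‖c.loc‖ < s := h1
      have h2' : c.mode = Mode.idle := h2
      refine ⟨Or.inl h2, ?_⟩
      change cellScore R w c < s
      simp only [cellScore, h2', h1'.le.trans hsR, if_true]
      exact h1'
  rw [scoreTail, hset, cellIntensity_union hμ hlamS R MeasurableSet.empty, volume_plane_norm_lt hs]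
  congr 3
  simp only [measure_empty, mul_zero, add_zero, ENNReal.toReal_mul]
  rw [ENNReal.toReal_ofReal hρ.le, ENNReal.toReal_ofReal (by positivity),
    ENNReal.toReal_ofReal hpI.le]
  ring

/-- Stating `hJ` abstractly serves both `Ioo 0 t`, which arises from a strict score bound at a
delayed cell, and `Ioc 0 w`, where all delayed candidates count. -/
theorem toReal_cellIntensity_union (hρ : 0 < ρ) (hpI : 0 < pI) (hpA : 0 < pA) (hpS : 0 ≤ pS)
    (hμ : 0 < μ) (hlamS : 0 < lamS) (hR : 0 < R)
    {a t : ℝ} (ha : 0 ≤ a) (ht : 0 ≤ t) {A : Set Plane} (hA : volume A = ENNReal.ofReal a)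
    {J : Set ℝ} (hJm : MeasurableSet J)
    (hJ : ∀ r : ℝ, 0 < r → expMeasure r J = ENNReal.ofReal (1 - Real.exp (-(r * t)))) :
    (cellIntensity ρ pI pA pS μ lamS
      (A ×ˢ ({Mode.idle} ×ˢ univ) ∪ {x : Plane | ‖x‖ ≤ R} ×ˢ ({Mode.idle}ᶜ ×ˢ J))).toReal
      = ρ * pI * a + ρ * (Real.pi * R ^ 2) *
        (pA * (1 - Real.exp (-(μ * t))) + pS * (1 - Real.exp (-(lamS * t)))) := by
  have h1 : 0 ≤ 1 - Real.exp (-(μ * t)) := by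
    have := Real.exp_le_one_iff.2 (neg_nonpos.2 (mul_nonneg hμ.le ht))
    linarith
  have h2 : 0 ≤ 1 - Real.exp (-(lamS * t)) := by
    have := Real.exp_le_one_iff.2 (neg_nonpos.2 (mul_nonneg hlamS.le ht))
    linarith
  rw [cellIntensity_union hμ hlamS R hJm, hA, volume_plane_norm_le hR.le, hJ _ hμ, hJ _ hlamS,
    ← ENNReal.ofReal_mul hρ.le, ← ENNReal.ofReal_mul (by positivity), ← ENNReal.ofReal_mul hρ.le,
    ← ENNReal.ofReal_mul hpA.le, ← ENNReal.ofReal_mul hpS,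
    ← ENNReal.ofReal_add (by positivity) (by positivity), ← ENNReal.ofReal_mul (by positivity),
    ← ENNReal.ofReal_add (by positivity) (by positivity), ENNReal.toReal_ofReal (by positivity)]
  ring

theorem scoreTail_delayed (hρ : 0 < ρ) (hpI : 0 < pI) (hpA : 0 < pA) (hpS : 0 ≤ pS)
    (hμ : 0 < μ) (hlamS : 0 < lamS) (hR : 0 < R) {t : ℝ} (ht : 0 < t) (htw : t ≤ w) :
    scoreTail (cellIntensity ρ pI pA pS μ lamS) (servingCandidates R w) (cellScore R w) (R + t)
      = ENNReal.ofReal (Real.exp (-(ρ * (Real.pi * R ^ 2) * (pI +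
          (pA * (1 - Real.exp (-(μ * t))) + pS * (1 - Real.exp (-(lamS * t)))))))) := by
  have hset : servingCandidates R w ∩ {c | cellScore R w c < R + t}
      = {x : Plane | ‖x‖ ≤ R} ×ˢ ({Mode.idle} ×ˢ univ)
        ∪ {x : Plane | ‖x‖ ≤ R} ×ˢ ({Mode.idle}ᶜ ×ˢ Ioo 0 t) := by
    ext c
    constructor
    · rintro ⟨h | h, hc⟩
      · have h' : c.mode = Mode.idle := h
        have hc' : cellScore R w c < R + t := hc
        simp only [cellScore, h', if_true] at hc'
        refine Or.inl ⟨?_, h, trivial⟩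
        change ‖c.loc‖ ≤ R
        split_ifs at hc' <;> linarith
      · have hc' : cellScore R w c < R + t := hc
        have h1 := h.1
        simp only [cellScore, h1, if_false] at hc'
        exact Or.inr ⟨h.2.2, h.1, h.2.1.1, by change c.wait < t; linarith⟩
    · rintro (⟨h1, h2, -⟩ | ⟨h1, h2, h3⟩)
      · have h1' : ‖c.loc‖ ≤ R := h1
        have h2' : c.mode = Mode.idle := h2
        refine ⟨Or.inl h2, ?_⟩
        change cellScore R w c < R + t
        simp only [cellScore, h2', h1', if_true]
        linarith
      · have h2' : c.mode ≠ Mode.idle := h2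
        have h3' : c.wait < t := h3.2
        refine ⟨Or.inr ⟨h2, ⟨h3.1, h3'.le.trans htw⟩, h1⟩, ?_⟩
        change cellScore R w c < R + t
        simp only [cellScore, h2', if_false]
        linarith
  rw [scoreTail, hset, toReal_cellIntensity_union hρ hpI hpA hpS hμ hlamS hR (by positivity)
    ht.le (volume_plane_norm_le hR.le) measurableSet_Ioo fun r hr => expMeasure_Ioo hr ht.le]
  congr 3
  ring

theorem scoreTail_far (hρ : 0 < ρ) (hpI : 0 < pI) (hpA : 0 < pA) (hpS : 0 ≤ pS)
    (hμ : 0 < μ) (hlamS : 0 < lamS) (hR : 0 < R) (hw : 0 ≤ w) {s : ℝ} (hs : R < s) :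
    scoreTail (cellIntensity ρ pI pA pS μ lamS) (servingCandidates R w) (cellScore R w) (w + s)
      = ENNReal.ofReal (Real.exp (-(ρ * pI * (Real.pi * s ^ 2) + ρ * (Real.pi * R ^ 2) *
          (pA * (1 - Real.exp (-(μ * w))) + pS * (1 - Real.exp (-(lamS * w))))))) := by
  have hset : servingCandidates R w ∩ {c | cellScore R w c < w + s}
      = {x : Plane | ‖x‖ < s} ×ˢ ({Mode.idle} ×ˢ univ)
        ∪ {x : Plane | ‖x‖ ≤ R} ×ˢ ({Mode.idle}ᶜ ×ˢ Ioc 0 w) := by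
    ext c
    constructor
    · rintro ⟨h | h, hc⟩
      · have h' : c.mode = Mode.idle := h
        have hc' : cellScore R w c < w + s := hc
        simp only [cellScore, h', if_true] at hc'
        refine Or.inl ⟨?_, h, trivial⟩
        change ‖c.loc‖ < s
        split_ifs at hc' <;> linarith
      · exact Or.inr ⟨h.2.2, h.1, h.2.1⟩
    · rintro (⟨h1, h2, -⟩ | ⟨h1, h2, h3⟩)
      · have h1' : ‖c.loc‖ < s := h1
        have h2' : c.mode = Mode.idle := h2
        refine ⟨Or.inl h2, ?_⟩
        change cellScore R w c < w + s
        simp only [cellScore, h2', if_true]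
        split_ifs <;> linarith
      · have h2' : c.mode ≠ Mode.idle := h2
        have h3' : c.wait ≤ w := h3.2
        refine ⟨Or.inr ⟨h2, h3, h1⟩, ?_⟩
        change cellScore R w c < w + s
        simp only [cellScore, h2', if_false]
        linarith
  rw [scoreTail, hset, toReal_cellIntensity_union hρ hpI hpA hpS hμ hlamS hR (by positivity)
    hw (volume_plane_norm_lt (hR.trans hs).le) measurableSet_Ioc fun r hr => expMeasure_Ioc hr hw]

end CellIntensity

/-! ### The law of the distance to the serving cell -/

section ServingLaw

open Set

variable {ρ pI pA pS μ lamS R w : ℝ}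

/-- The probability `β t - β 0` that a cell is not idle but available by time `t`. -/
noncomputable def delayedProb (pA pS μ lamS t : ℝ) : ℝ :=
  pA * (1 - Real.exp (-(μ * t))) + pS * (1 - Real.exp (-(lamS * t)))

theorem delayedProb_nonneg {t : ℝ} (hpA : 0 ≤ pA) (hpS : 0 ≤ pS) (hμ : 0 ≤ μ) (hlamS : 0 ≤ lamS)
    (ht : 0 ≤ t) : 0 ≤ delayedProb pA pS μ lamS t := by
  have h1 := Real.exp_le_one_iff.2 (neg_nonpos.2 (mul_nonneg hμ ht))
  have h2 := Real.exp_le_one_iff.2 (neg_nonpos.2 (mul_nonneg hlamS ht))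
  exact add_nonneg (mul_nonneg hpA (by linarith)) (mul_nonneg hpS (by linarith))

theorem hasDerivAt_delayedProb (pA pS μ lamS t : ℝ) :
    HasDerivAt (delayedProb pA pS μ lamS)
      (pA * (μ * Real.exp (-(μ * t))) + pS * (lamS * Real.exp (-(lamS * t)))) t := by
  have h := fun r : ℝ => (hasDerivAt_neg_exp_mul_exp (r := r) (x := t)).const_add 1
  exact ((h μ).const_mul pA).add ((h lamS).const_mul pS)

/-- The two exponential densities, weighted by `pA` and `pS`, add up to the derivative of
`delayedProb`. The integrand is thus the derivative of `-exp (-(a * (pI + delayedProb t))) / a`. -/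
theorem lintegral_delayed (hpA : 0 < pA) (hpS : 0 ≤ pS) (hμ : 0 < μ) (hlamS : 0 < lamS)
    (hw : 0 ≤ w) {a : ℝ} (ha : 0 < a) :
    ENNReal.ofReal pA * ∫⁻ t, (Ioc 0 w).indicator (fun t => ENNReal.ofReal
        (Real.exp (-(a * (pI + delayedProb pA pS μ lamS t))))) t ∂(expMeasure μ)
      + ENNReal.ofReal pS * ∫⁻ t, (Ioc 0 w).indicator (fun t => ENNReal.ofReal
        (Real.exp (-(a * (pI + delayedProb pA pS μ lamS t))))) t ∂(expMeasure lamS)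
      = ENNReal.ofReal ((Real.exp (-(a * pI))
        - Real.exp (-(a * (pI + delayedProb pA pS μ lamS w)))) / a) := by
  have hcont : Continuous (delayedProb pA pS μ lamS) := by unfold delayedProb; fun_prop
  have hm : Measurable fun t => ENNReal.ofReal
      (Real.exp (-(a * (pI + delayedProb pA pS μ lamS t)))) :=
    ENNReal.measurable_ofReal.comp (by fun_prop : Continuous fun t =>
      Real.exp (-(a * (pI + delayedProb pA pS μ lamS t)))).measurable
  have h : ∀ p r : ℝ, 0 ≤ p → 0 < r →
      ENNReal.ofReal p * ∫⁻ t, (Ioc 0 w).indicator (fun t => ENNReal.ofReal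
        (Real.exp (-(a * (pI + delayedProb pA pS μ lamS t))))) t ∂(expMeasure r)
      = ∫⁻ t in Ioc 0 w, ENNReal.ofReal (p * (r * Real.exp (-(r * t)))
        * Real.exp (-(a * (pI + delayedProb pA pS μ lamS t)))) := by
    intro p r hp hr
    have hpt : ∀ t, ENNReal.ofReal p * (ENNReal.ofReal (r * Real.exp (-(r * t)))
        * (Ioc 0 w).indicator (fun t => ENNReal.ofReal
          (Real.exp (-(a * (pI + delayedProb pA pS μ lamS t))))) t)
        = (Ioc 0 w).indicator (fun t => ENNReal.ofReal (p * (r * Real.exp (-(r * t)))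
          * Real.exp (-(a * (pI + delayedProb pA pS μ lamS t))))) t := by
      intro t
      by_cases ht : t ∈ Ioc 0 w
      · rw [indicator_of_mem ht, indicator_of_mem ht, ← ENNReal.ofReal_mul (by positivity),
          ← ENNReal.ofReal_mul hp, mul_assoc p]
      · rw [indicator_of_notMem ht, indicator_of_notMem ht, mul_zero, mul_zero]
    rw [lintegral_expMeasure (hm.indicator measurableSet_Ioc),
      ← lintegral_const_mul' _ _ ENNReal.ofReal_ne_top, lintegral_congr hpt,
      lintegral_indicator measurableSet_Ioc, Measure.restrict_restrict measurableSet_Ioc,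
      inter_eq_left.2 Ioc_subset_Ioi_self]
  rw [h pA μ hpA.le hμ, h pS lamS hpS hlamS, ← lintegral_add_left (by fun_prop)]
  have h2 : ∀ t, ENNReal.ofReal (pA * (μ * Real.exp (-(μ * t)))
        * Real.exp (-(a * (pI + delayedProb pA pS μ lamS t))))
      + ENNReal.ofReal (pS * (lamS * Real.exp (-(lamS * t)))
        * Real.exp (-(a * (pI + delayedProb pA pS μ lamS t))))
      = ENNReal.ofReal ((pA * (μ * Real.exp (-(μ * t))) + pS * (lamS * Real.exp (-(lamS * t))))
        * Real.exp (-(a * (pI + delayedProb pA pS μ lamS t)))) := by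
    intro t
    rw [← ENNReal.ofReal_add (by positivity) (by positivity), add_mul]
  simp only [h2]
  rw [setLIntegral_Ioc_of_hasDerivAt
    (g := fun t => -Real.exp (-(a * (pI + delayedProb pA pS μ lamS t))) / a) hw (fun t => ?_)
    (by fun_prop) fun t _ => by positivity]
  · congr 1
    have : delayedProb pA pS μ lamS 0 = 0 := by simp [delayedProb]
    rw [this]; ring_nf
  · convert! (((hasDerivAt_delayedProb pA pS μ lamS t).const_add pI).const_mul a).neg.exp.neg.div_const a
      using 1
    field_simp
    rfl

/-- Idle cells contribute exponential integrals in the area variable, on either side of `V = π R ^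
2`. For delayed cells the density factors into location and time, giving the disc average `D / V`
times the probability of delayed access. Leaving `D` abstract admits `κ = 0`, where `D = V`,
alongside the positive `κ` of the coverage formula. -/
theorem lintegral_firstPointLaw_area (hρ : 0 < ρ) (hpI : 0 < pI) (hpA : 0 < pA) (hpS : 0 ≤ pS)
    (hμ : 0 < μ) (hlamS : 0 < lamS) (hR : 0 < R) (hw : 0 ≤ w) {κ D : ℝ} (hκ : 0 ≤ κ)
    (hD0 : 0 ≤ D)
    (hD : ∫⁻ u in Ioc 0 (Real.pi * R ^ 2), ENNReal.ofReal (Real.exp (-(κ * u)))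
      = ENNReal.ofReal D) :
    ∫⁻ c, ENNReal.ofReal (Real.exp (-(κ * (Real.pi * ‖c.loc‖ ^ 2))))
      ∂(firstPointLaw (cellIntensity ρ pI pA pS μ lamS) (servingCandidates R w) (cellScore R w))
      = ENNReal.ofReal (ρ * pI / (κ + ρ * pI) *
          (1 - Real.exp (-((κ + ρ * pI) * (Real.pi * R ^ 2)))
            + Real.exp (-(ρ * (Real.pi * R ^ 2) * delayedProb pA pS μ lamS w))
              * Real.exp (-((κ + ρ * pI) * (Real.pi * R ^ 2))))
        + D / (Real.pi * R ^ 2) * (Real.exp (-(ρ * (Real.pi * R ^ 2) * pI))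
          - Real.exp (-(ρ * (Real.pi * R ^ 2) * (pI + delayedProb pA pS μ lamS w))))) := by
  have hB : 0 ≤ delayedProb pA pS μ lamS w :=
    delayedProb_nonneg hpA.le hpS hμ.le hlamS.le hw
  set V : ℝ := Real.pi * R ^ 2 with hV
  have hVpos : 0 < V := by positivity
  set B : ℝ := delayedProb pA pS μ lamS w with hBdef
  have hfin := cellIntensity_score_lt_ne_top (ρ := ρ) (pI := pI) (pA := pA) (pS := pS) hμ hlamS hR hw
  have hG := measurableSet_servingCandidates R w
  have htail : Measurable fun c => scoreTail (cellIntensity ρ pI pA pS μ lamS)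
      (servingCandidates R w) (cellScore R w) (cellScore R w c) :=
    (measurable_scoreTail hfin).comp (measurable_cellScore R w)
  have hloc : Measurable fun c : Cell => ENNReal.ofReal
      (Real.exp (-(κ * (Real.pi * ‖c.loc‖ ^ 2)))) := by
    have := measurable_cell_loc
    fun_prop
  have hnorm : ∀ x : Plane, ‖x‖ ≤ R ↔ Real.pi * ‖x‖ ^ 2 ≤ V := fun x => by
    rw [hV, mul_le_mul_iff_right₀ Real.pi_pos, sq_le_sq₀ (norm_nonneg x) hR.le]
  let φ : ℝ → ℝ≥0∞ := fun u =>
    (Iic V).indicator (fun u => ENNReal.ofReal (Real.exp (-((κ + ρ * pI) * u)))) u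
      + (Ioi V).indicator (fun u => ENNReal.ofReal (Real.exp (-(ρ * V * B)))
        * ENNReal.ofReal (Real.exp (-((κ + ρ * pI) * u)))) u
  let ψ : ℝ → ℝ≥0∞ := (Iic V).indicator fun u => ENNReal.ofReal (Real.exp (-(κ * u)))
  let η : ℝ → ℝ≥0∞ := (Ioc 0 w).indicator fun t =>
    ENNReal.ofReal (Real.exp (-(ρ * V * (pI + delayedProb pA pS μ lamS t))))
  let F : Cell → ℝ≥0∞ := (servingCandidates R w).indicator fun c =>
    scoreTail (cellIntensity ρ pI pA pS μ lamS) (servingCandidates R w) (cellScore R w)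
      (cellScore R w c) * ENNReal.ofReal (Real.exp (-(κ * (Real.pi * ‖c.loc‖ ^ 2))))
  have hF : Measurable F := (htail.mul hloc).indicator hG
  have hφ : Measurable φ := by
    refine Measurable.add (Measurable.indicator ?_ measurableSet_Iic)
      (Measurable.indicator ?_ measurableSet_Ioi) <;> fun_prop
  have hψ : Measurable ψ := Measurable.indicator (by fun_prop) measurableSet_Iic
  have hη : Measurable η := Measurable.indicator (by unfold delayedProb; fun_prop) measurableSet_Ioc
  have hFidle : ∀ x : Plane, F (x, Mode.idle, 0) = φ (Real.pi * ‖x‖ ^ 2) := by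
    intro x
    have hmem : ((x, Mode.idle, 0) : Cell) ∈ servingCandidates R w := Or.inl rfl
    simp only [F, φ]
    rw [indicator_of_mem hmem]
    by_cases hx : ‖x‖ ≤ R
    · have hscore : cellScore R w (x, Mode.idle, 0) = ‖x‖ := by
        simp [cellScore, Cell.mode, Cell.loc, hx]
      rw [hscore, scoreTail_near hρ hpI hμ hlamS hw (norm_nonneg x) hx,
        indicator_of_mem (show _ ∈ Iic V from (hnorm x).1 hx),
        indicator_of_notMem (show _ ∉ Ioi V from not_lt.2 ((hnorm x).1 hx)), add_zero,
        ← ENNReal.ofReal_mul (Real.exp_pos _).le, ← Real.exp_add]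
      congr 2
      simp only [Cell.loc]; ring
    · have hscore : cellScore R w (x, Mode.idle, 0) = w + ‖x‖ := by
        simp [cellScore, Cell.mode, Cell.loc, hx]
      rw [hscore, scoreTail_far hρ hpI hpA hpS hμ hlamS hR hw (not_le.1 hx),
        indicator_of_notMem (show _ ∉ Iic V from fun h => hx ((hnorm x).2 h)),
        indicator_of_mem (show _ ∈ Ioi V from not_le.1 fun h => hx ((hnorm x).2 h)), zero_add,
        ← ENNReal.ofReal_mul (Real.exp_pos _).le, ← ENNReal.ofReal_mul (Real.exp_pos _).le,
        ← Real.exp_add, ← Real.exp_add]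
      congr 2
      simp only [Cell.loc, hBdef, delayedProb, hV]; ring
  have hFdelayed : ∀ (m : Mode) (x : Plane) (t : ℝ), m ≠ Mode.idle →
      F (x, m, t) = ψ (Real.pi * ‖x‖ ^ 2) * η t := by
    intro m x t hm
    simp only [F, ψ, η]
    by_cases ht : t ∈ Ioc 0 w
    · by_cases hx : ‖x‖ ≤ R
      · have hmem : ((x, m, t) : Cell) ∈ servingCandidates R w := Or.inr ⟨hm, ht, hx⟩
        have hscore : cellScore R w (x, m, t) = R + t := by
          simp [cellScore, Cell.mode, Cell.wait, hm]
        rw [indicator_of_mem hmem, indicator_of_mem ht,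
          indicator_of_mem (show _ ∈ Iic V from (hnorm x).1 hx), hscore,
          scoreTail_delayed hρ hpI hpA hpS hμ hlamS hR ht.1 ht.2, mul_comm]
        rfl
      · rw [indicator_of_notMem (fun h : _ ∈ Iic V => hx ((hnorm x).2 h)), zero_mul,
          indicator_of_notMem]
        rintro (h | h)
        · exact hm h
        · exact hx h.2.2
    · rw [indicator_of_notMem ht, mul_zero, indicator_of_notMem]
      rintro (h | h)
      · exact hm h
      · exact ht h.2.1
  have hM := lintegral_delayed (pI := pI) hpA hpS hμ hlamS hw (a := ρ * V) (by positivity)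
  set M : ℝ := (Real.exp (-(ρ * V * pI)) - Real.exp (-(ρ * V * (pI + B)))) / (ρ * V) with hMdef
  have hM0 : 0 ≤ M := by
    refine div_nonneg (sub_nonneg.2 (Real.exp_le_exp.2 (neg_le_neg ?_))) (by positivity)
    exact mul_le_mul_of_nonneg_left (by linarith) (by positivity)
  have hκc : 0 < κ + ρ * pI := by positivity
  have hE1 : Real.exp (-((κ + ρ * pI) * V)) ≤ 1 :=
    Real.exp_le_one_iff.2 (neg_nonpos.2 (by positivity))
  have hIic : ∀ f : ℝ → ℝ≥0∞, ∫⁻ u in Ioi 0, (Iic V).indicator f u = ∫⁻ u in Ioc 0 V, f u := by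
    intro f
    rw [lintegral_indicator measurableSet_Iic, Measure.restrict_restrict measurableSet_Iic,
      inter_comm, Ioi_inter_Iic]
  have hIoi : ∀ f : ℝ → ℝ≥0∞, ∫⁻ u in Ioi 0, (Ioi V).indicator f u = ∫⁻ u in Ioi V, f u := by
    intro f
    rw [lintegral_indicator measurableSet_Ioi, Measure.restrict_restrict measurableSet_Ioi,
      Ioi_inter_Ioi, max_eq_left hVpos.le]
  have hφint : ∫⁻ u in Ioi 0, φ u = ENNReal.ofReal ((1 - Real.exp (-((κ + ρ * pI) * V))
      + Real.exp (-(ρ * V * B)) * Real.exp (-((κ + ρ * pI) * V))) / (κ + ρ * pI)) := by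
    simp only [φ]
    rw [lintegral_add_left (Measurable.indicator (by fun_prop) measurableSet_Iic), hIic, hIoi,
      lintegral_const_mul _ (by fun_prop), setLIntegral_Ioc_exp hκc hVpos.le,
      setLIntegral_Ioi_exp' hκc, ← ENNReal.ofReal_mul (Real.exp_pos _).le, mul_zero, neg_zero,
      Real.exp_zero, ← ENNReal.ofReal_add (div_nonneg (by linarith) hκc.le) (by positivity)]
    congr 1
    ring
  rw [firstPointLaw, lintegral_withDensity_eq_lintegral_mul _ htail hloc,
    ← lintegral_indicator hG]
  change ∫⁻ c, F c ∂(cellIntensity ρ pI pA pS μ lamS) = _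
  rw [lintegral_cellIntensity hμ hlamS hF]
  have hx : ∀ x : Plane, ENNReal.ofReal pI * F (x, Mode.idle, 0)
      + ENNReal.ofReal pA * ∫⁻ t, F (x, Mode.active, t) ∂(expMeasure μ)
      + ENNReal.ofReal pS * ∫⁻ t, F (x, Mode.sleep, t) ∂(expMeasure lamS)
      = (fun u => ENNReal.ofReal pI * φ u + ψ u * ENNReal.ofReal M) (Real.pi * ‖x‖ ^ 2) := by
    intro x
    simp only [hFidle, hFdelayed Mode.active _ _ (by simp), hFdelayed Mode.sleep _ _ (by simp)]
    rw [lintegral_const_mul _ hη, lintegral_const_mul _ hη, ← hM]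
    simp only [η]
    ring
  simp only [hx]
  rw [lintegral_plane_area (f := fun u => ENNReal.ofReal pI * φ u + ψ u * ENNReal.ofReal M)
      ((hφ.const_mul _).add (hψ.mul_const _)),
    lintegral_add_left (hφ.const_mul _), lintegral_const_mul _ hφ, lintegral_mul_const _ hψ, hφint,
    hIic, hD, ← ENNReal.ofReal_mul hpI.le, ← ENNReal.ofReal_mul hD0,
    ← ENNReal.ofReal_add, ← ENNReal.ofReal_mul hρ.le]
  · congr 1
    rw [hMdef]
    field_simp
  · refine mul_nonneg hpI.le (div_nonneg (add_nonneg (by linarith) (by positivity)) hκc.le)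
  · exact mul_nonneg hD0 hM0

/-- The case `κ = 0`. Total mass one is exactly what upgrades the cover bounds to an identity of
laws. -/
theorem firstPointLaw_univ (hρ : 0 < ρ) (hpI : 0 < pI) (hpA : 0 < pA) (hpS : 0 ≤ pS)
    (hμ : 0 < μ) (hlamS : 0 < lamS) (hR : 0 < R) (hw : 0 ≤ w) :
    firstPointLaw (cellIntensity ρ pI pA pS μ lamS) (servingCandidates R w) (cellScore R w) univ
      = 1 := by
  have h := lintegral_firstPointLaw_area hρ hpI hpA hpS hμ hlamS hR hw le_rfl
    (D := Real.pi * R ^ 2) (by positivity) (by simp)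
  have hV : 0 < Real.pi * R ^ 2 := by positivity
  rw [div_self hV.ne', zero_add, div_self (by positivity)] at h
  simp only [zero_mul, neg_zero, Real.exp_zero, ENNReal.ofReal_one, lintegral_one, one_mul] at h
  rw [h, ← Real.exp_add, ← ENNReal.ofReal_one]
  congr 1
  ring_nf

end ServingLaw

/-! ### The coverage probability -/

section Coverage

open Set Filter Topology

variable {Ω : Type*} [MeasurableSpace Ω] {P : Measure Ω}
  {ρ pI pA pS μ lamS R w : ℝ} {Φ : Ω → Set Cell}

theorem ae_exists_servingCandidate (hΦ : IsPoissonPP Φ (cellIntensity ρ pI pA pS μ lamS) P)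
    (hρ : 0 < ρ) (hpI : 0 < pI) (hpA : 0 < pA) (hpS : 0 ≤ pS) (hμ : 0 < μ) (hlamS : 0 < lamS)
    (hR : 0 < R) (hw : 0 ≤ w) : ∀ᵐ ω ∂P, (Φ ω ∩ servingCandidates R w).Nonempty := by
  have hB : 0 ≤ delayedProb pA pS μ lamS w :=
    delayedProb_nonneg hpA.le hpS hμ.le hlamS.le hw
  have hbound : ∀ n : ℕ, P {ω | ¬(Φ ω ∩ servingCandidates R w).Nonempty}
      ≤ ENNReal.ofReal (Real.exp (-(ρ * pI * Real.pi * R * ((n : ℝ) + 1)))) := by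
    intro n
    have hs : R < R + ((n : ℝ) + 1) := by linarith [n.cast_nonneg (α := ℝ)]
    have hmeas : MeasurableSet (servingCandidates R w ∩
        {c | cellScore R w c < w + (R + ((n : ℝ) + 1))}) :=
      (measurableSet_servingCandidates R w).inter
        (measurableSet_lt (measurable_cellScore R w) measurable_const)
    have h0 := hΦ.measure_count_eq_zero hmeas (cellIntensity_score_lt_ne_top hμ hlamS hR hw _)
    have htail := scoreTail_far hρ hpI hpA hpS hμ hlamS hR hw hs
    rw [scoreTail, ← h0] at htail
    refine (measure_mono (t := {ω | pointCount Φ (servingCandidates R w ∩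
      {c | cellScore R w c < w + (R + ((n : ℝ) + 1))}) ω = 0}) fun ω hω => ?_).trans
        (htail.trans_le ?_)
    · by_contra hne
      obtain ⟨c, hc, hcG⟩ := (pointCount_ne_zero_iff _ _).1 hne
      exact hω ⟨c, hc, hcG.1⟩
    · refine ENNReal.ofReal_le_ofReal (Real.exp_le_exp.2 (neg_le_neg ?_))
      have h3 : 0 ≤ ρ * (Real.pi * R ^ 2) * delayedProb pA pS μ lamS w := by positivity
      -- A bound linear in `n` suffices to send the void probability to zero; far idle cells alone
      -- provide it.
      have h4 : R * ((n : ℝ) + 1) ≤ (R + ((n : ℝ) + 1)) ^ 2 := by nlinarith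
      have h5 : 0 ≤ ρ * pI * Real.pi := by positivity
      have h6 := mul_le_mul_of_nonneg_left h4 h5
      unfold delayedProb at h3
      linarith
  have hlim : Tendsto (fun n : ℕ => ENNReal.ofReal
      (Real.exp (-(ρ * pI * Real.pi * R * ((n : ℝ) + 1))))) atTop (𝓝 (ENNReal.ofReal 0)) := by
    refine ENNReal.tendsto_ofReal (Real.tendsto_exp_neg_atTop_nhds_zero.comp ?_)
    exact (tendsto_atTop_add_const_right _ _ tendsto_natCast_atTop_atTop).const_mul_atTop
      (by positivity)
  have h := ge_of_tendsto' hlim hbound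
  rw [ENNReal.ofReal_zero, nonpos_iff_eq_zero] at h
  exact h

variable [IsProbabilityMeasure P]

/-- Almost surely, the serving distance is the distance to some candidate of lowest score, and
it is positive. -/
theorem ae_exists_isFirstPoint_servingDist
    (hΦ : IsPoissonPP Φ (cellIntensity ρ pI pA pS μ lamS) P)
    (hρ : 0 < ρ) (hpI : 0 < pI) (hpA : 0 < pA) (hpS : 0 ≤ pS) (hμ : 0 < μ) (hlamS : 0 < lamS)
    (hR : 0 < R) (hw : 0 ≤ w) :
    ∀ᵐ ω ∂P, 0 < servingDist (Φ ω) R w ∧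
      ∃ b, IsFirstPoint (Φ ω) (servingCandidates R w) (cellScore R w) b
        ∧ ‖b.loc‖ = servingDist (Φ ω) R w := by
  have hfinite : ∀ᵐ ω ∂P, ∀ n : ℕ,
      (Φ ω ∩ (servingCandidates R w ∩ {c | cellScore R w c < n})).Finite :=
    ae_all_iff.2 fun n => hΦ.ae_finite_inter ((measurableSet_servingCandidates R w).inter
        (measurableSet_lt (measurable_cellScore R w) measurable_const))
      (cellIntensity_score_lt_ne_top hμ hlamS hR hw n)
  have horigin : cellIntensity ρ pI pA pS μ lamS ({(0 : Plane)} ×ˢ univ) = 0 := by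
    rw [cellIntensity_prod hμ hlamS]; simp
  filter_upwards [ae_exists_servingCandidate hΦ hρ hpI hpA hpS hμ hlamS hR hw, hfinite,
    hΦ.ae_notMem_of_null (cellIntensity_not_idle_wait_nonpos hμ hlamS),
    hΦ.ae_notMem_of_null horigin] with ω ⟨c₀, hc₀, hc₀G⟩ hfin hwait horig
  have hiff := isServing_iff_isFirstPoint (S := Φ ω) (R := R) hw
    fun c hc hci => not_le.1 fun h => hwait c hc ⟨hci, h⟩
  obtain ⟨n, hn⟩ := exists_nat_gt (cellScore R w c₀)
  obtain ⟨b₁, ⟨hb₁S, hb₁G, hb₁n⟩, hb₁⟩ :=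
    (hfin n).exists_minimalFor (cellScore R w) _ ⟨c₀, hc₀, hc₀G, hn⟩
  have hb₁min : ∀ c ∈ Φ ω, c ∈ servingCandidates R w → cellScore R w b₁ ≤ cellScore R w c := by
    intro c hc hcG
    by_contra hlt
    have hlt' := not_le.1 hlt
    exact hlt (hb₁ ⟨hc, hcG, lt_trans hlt' hb₁n⟩ hlt'.le)
  have hfirst : {b | IsFirstPoint (Φ ω) (servingCandidates R w) (cellScore R w) b}.Finite := by
    refine (hfin n).subset ?_
    rintro b ⟨hbS, hbG, hb⟩
    exact ⟨hbS, hbG, lt_of_le_of_lt (hb b₁ hb₁S hb₁G) hb₁n⟩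
  -- Ties in the score need not be ruled out: the infimum in `servingDist` is attained by the
  -- nearest of the finitely many minimisers.
  obtain ⟨b, hb, hbmin⟩ := Set.exists_min_image _ (fun c : Cell => ‖c.loc‖) hfirst
    ⟨b₁, hb₁S, hb₁G, hb₁min⟩
  have hdist : servingDist (Φ ω) R w = ‖b.loc‖ := by
    refine IsLeast.csInf_eq ⟨⟨b, (hiff b).2 hb, rfl⟩, ?_⟩
    rintro _ ⟨c, hc, rfl⟩
    exact hbmin c ((hiff c).1 hc)
  rw [hdist]
  refine ⟨norm_pos_iff.2 fun h => horig b hb.1 ⟨h, trivial⟩, b, hb, rfl⟩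

/-- Multiplying out is legitimate even for zero or infinite interference, because the threshold is
finite and nonzero. -/
theorem ofReal_lt_sinr_iff {Ptx γ h r : ℝ} (hPtx : 0 < Ptx) (hγ : 0 < γ) (hr : 0 < r)
    (T : Set (Plane × ℝ)) :
    ENNReal.ofReal γ < sinr Ptx 4 0 h r T ↔
      ENNReal.ofReal (γ * r ^ 4 / Ptx) * interferencePower Ptx 4 T < ENNReal.ofReal h := by
  have hrpow : r ^ (-4 : ℝ) = (r ^ 4)⁻¹ := by
    rw [Real.rpow_neg hr.le, show (4 : ℝ) = ((4 : ℕ) : ℝ) by norm_num, Real.rpow_natCast]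
  have hk : 0 < r ^ 4 / Ptx := by positivity
  have h1 : ENNReal.ofReal (r ^ 4 / Ptx) * (ENNReal.ofReal γ * interferencePower Ptx 4 T)
      = ENNReal.ofReal (γ * r ^ 4 / Ptx) * interferencePower Ptx 4 T := by
    rw [← mul_assoc, ← ENNReal.ofReal_mul hk.le]
    congr 2; ring
  have h2 : ENNReal.ofReal (r ^ 4 / Ptx) * ENNReal.ofReal (Ptx * h * r ^ (-4 : ℝ))
      = ENNReal.ofReal h := by
    rw [← ENNReal.ofReal_mul hk.le, hrpow]
    congr 1; field_simp
  rw [sinr, ENNReal.ofReal_zero, add_zero,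
    ENNReal.lt_div_iff_mul_lt (Or.inr ENNReal.ofReal_ne_top)
      (Or.inr (ENNReal.ofReal_pos.2 hγ).ne'), ← h1, ← h2]
  exact (ENNReal.mul_lt_mul_iff_right (ENNReal.ofReal_pos.2 hk).ne' ENNReal.ofReal_ne_top).symm

theorem measure_scaled_interference_lt {ζ Ptx γ r : ℝ} {Ψ : Ω → Set (Plane × ℝ)} {h : Ω → ℝ}
    (hΨ : IsPoissonPP Ψ (interfererIntensity ρ pA ζ) P) (hρ : 0 < ρ) (hpA : 0 < pA) (hζ : 0 < ζ)
    (hPtx : 0 < Ptx) (hγ : 0 < γ) (hr : 0 < r) (hh : Measurable h)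
    (hlaw : P.map h = expMeasure ζ)
    (hind : IndepFun (fun ω => interferencePower Ptx 4 (Ψ ω)) h P) :
    P {ω | ENNReal.ofReal (γ * r ^ 4 / Ptx) * interferencePower Ptx 4 (Ψ ω)
        < ENNReal.ofReal (h ω)}
      = ENNReal.ofReal (Real.exp (-(pA * √γ * Real.pi / 2 * (ρ * (Real.pi * r ^ 2))))) := by
  have := isProbabilityMeasure_expMeasure hζ
  have hI : Measurable fun ω => interferencePower Ptx 4 (Ψ ω) :=
    (measurable_interferencePower Ptx 4 Ψ).mono hΨ.pointSigma_le le_rfl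
  have hset : MeasurableSet {p : ℝ≥0∞ × ℝ |
      ENNReal.ofReal (γ * r ^ 4 / Ptx) * p.1 < ENNReal.ofReal p.2} :=
    measurableSet_lt (measurable_fst.const_mul _) measurable_snd.ennreal_ofReal
  have hmap := (indepFun_iff_map_prod_eq_prod_map_map hI.aemeasurable hh.aemeasurable).1 hind
  have h1 := Measure.map_apply (μ := P) (hI.prodMk hh) hset
  rw [hmap, hlaw, Measure.prod_apply hset, lintegral_map (measurable_measure_prodMk_left hset) hI]
    at h1
  refine h1.symm.trans ?_
  rw [← lintegral_expNeg_interferencePower hΨ hρ hpA hζ hPtx hγ hr]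
  exact lintegral_congr fun ω => expMeasure_ofReal_gt hζ
    (ENNReal.ofReal (γ * r ^ 4 / Ptx) * interferencePower Ptx 4 (Ψ ω))

/-- Conditioning on the serving distance, then on the interference: the inner probability is
`measure_scaled_interference_lt`, and what remains is a mean over the law of the distance. -/
theorem measure_covered (hρ : 0 < ρ) (hpI : 0 < pI) (hpA : 0 < pA) (hpS : 0 ≤ pS)
    (hμ : 0 < μ) (hlamS : 0 < lamS) (hR : 0 < R) (hw : 0 ≤ w) {ζ Ptx γ : ℝ} (hζ : 0 < ζ)
    (hPtx : 0 < Ptx) (hγ : 0 < γ) {Ψ : Ω → Set (Plane × ℝ)} {h : Ω → ℝ}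
    (hΦ : IsPoissonPP Φ (cellIntensity ρ pI pA pS μ lamS) P)
    (hΨ : IsPoissonPP Ψ (interfererIntensity ρ pA ζ) P)
    (hh : Measurable h) (hlaw : P.map h = expMeasure ζ)
    (hind : iIndep ![pointSigma Φ, pointSigma Ψ, MeasurableSpace.comap h inferInstance] P) :
    P {ω | ENNReal.ofReal γ < sinr Ptx 4 0 (h ω) (servingDist (Φ ω) R w) (Ψ ω)}
      = ∫⁻ c, ENNReal.ofReal (Real.exp
          (-(pA * √γ * Real.pi / 2 * ρ * (Real.pi * ‖c.loc‖ ^ 2))))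
        ∂(firstPointLaw (cellIntensity ρ pI pA pS μ lamS) (servingCandidates R w)
          (cellScore R w)) := by
  have hserve := ae_exists_isFirstPoint_servingDist hΦ hρ hpI hpA hpS hμ hlamS hR hw
  -- The serving distance is replaced by a version measurable for `pointSigma Φ`, so that the
  -- independence hypothesis applies to it.
  obtain ⟨r', hr'm, hr', hr'law⟩ := hΦ.exists_measurable_firstPoint
    (measurableSet_servingCandidates R w) (measurable_cellScore R w) (cellScore_nonneg hR hw)
    (cellIntensity_score_lt_ne_top hμ hlamS hR hw) measurable_cell_loc.norm
    (firstPointLaw_univ hρ hpI hpA hpS hμ hlamS hR hw) (hserve.mono fun ω hω => hω.2)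
  have hm : ∀ i, (![pointSigma Φ, pointSigma Ψ, MeasurableSpace.comap h inferInstance] :
      Fin 3 → MeasurableSpace Ω) i ≤ ‹MeasurableSpace Ω› := by
    intro i
    fin_cases i
    · exact hΦ.pointSigma_le
    · exact hΨ.pointSigma_le
    · exact hh.comap_le
  have hIm := measurable_interferencePower Ptx 4 Ψ
  have hI : Measurable fun ω => interferencePower Ptx 4 (Ψ ω) :=
    hIm.mono hΨ.pointSigma_le le_rfl
  have hrm : Measurable r' := hr'm.mono hΦ.pointSigma_le le_rfl
  have hIh : IndepFun (fun ω => interferencePower Ptx 4 (Ψ ω)) h P := by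
    have := hind.indep (i := 1) (j := 2) (by decide)
    exact indep_of_indep_of_le_left this hIm.comap_le
  have hrIh : IndepFun r' (fun ω => (interferencePower Ptx 4 (Ψ ω), h ω)) P := by
    -- Fubini needs `r'` independent of the pair of interference and gain, so the joint independence
    -- is grouped as one σ-algebra against two.
    have := indep_iSup_of_disjoint hm hind (S := {0}) (T := {1, 2}) (by simp)
    refine indep_of_indep_of_le_left (indep_of_indep_of_le_right this ?_) ?_
    · refine (Measurable.prodMk (m := ⨆ i ∈ ({1, 2} : Set (Fin 3)), (![pointSigma Φ, pointSigma Ψ,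
        MeasurableSpace.comap h inferInstance] : Fin 3 → MeasurableSpace Ω) i) ?_ ?_).comap_le
      · exact hIm.mono (le_iSup₂_of_le (f := fun i (_ : i ∈ ({1, 2} : Set (Fin 3))) =>
          (![pointSigma Φ, pointSigma Ψ, MeasurableSpace.comap h inferInstance] :
            Fin 3 → MeasurableSpace Ω) i) 1 (by simp) le_rfl) le_rfl
      · exact (comap_measurable h).mono (le_iSup₂_of_le (f := fun i
          (_ : i ∈ ({1, 2} : Set (Fin 3))) =>
          (![pointSigma Φ, pointSigma Ψ, MeasurableSpace.comap h inferInstance] :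
            Fin 3 → MeasurableSpace Ω) i) 2 (by simp) le_rfl) le_rfl
    · exact hr'm.comap_le.trans (le_iSup₂_of_le (f := fun i (_ : i ∈ ({0} : Set (Fin 3))) =>
          (![pointSigma Φ, pointSigma Ψ, MeasurableSpace.comap h inferInstance] :
            Fin 3 → MeasurableSpace Ω) i) 0 (by simp) le_rfl)
  have hset : MeasurableSet {p : ℝ × ℝ≥0∞ × ℝ |
      ENNReal.ofReal (γ * p.1 ^ 4 / Ptx) * p.2.1 < ENNReal.ofReal p.2.2} :=
    measurableSet_lt (Measurable.mul (by fun_prop) (by fun_prop)) (by fun_prop)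
  have hevent : P {ω | ENNReal.ofReal γ < sinr Ptx 4 0 (h ω) (servingDist (Φ ω) R w) (Ψ ω)}
      = P ((fun ω => (r' ω, interferencePower Ptx 4 (Ψ ω), h ω)) ⁻¹' {p : ℝ × ℝ≥0∞ × ℝ |
        ENNReal.ofReal (γ * p.1 ^ 4 / Ptx) * p.2.1 < ENNReal.ofReal p.2.2}) := by
    refine measure_congr ?_
    filter_upwards [hserve, hr'] with ω hω heq
    refine propext ?_
    change _ < sinr Ptx 4 0 (h ω) (servingDist (Φ ω) R w) (Ψ ω) ↔ _
    rw [ofReal_lt_sinr_iff hPtx hγ hω.1, heq]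
    rfl
  have hpos : ∀ᵐ x ∂(P.map r'), 0 < x := by
    refine (ae_map_iff hrm.aemeasurable measurableSet_Ioi).2 ?_
    filter_upwards [hserve, hr'] with ω hω heq
    rw [← heq]
    exact hω.1
  rw [hevent, ← Measure.map_apply (hrm.prodMk (hI.prodMk hh)) hset,
    (indepFun_iff_map_prod_eq_prod_map_map hrm.aemeasurable (hI.prodMk hh).aemeasurable).1 hrIh,
    Measure.prod_apply hset]
  have hinner : ∀ᵐ x ∂(P.map r'), (P.map fun ω => (interferencePower Ptx 4 (Ψ ω), h ω))
      (Prod.mk x ⁻¹' {p : ℝ × ℝ≥0∞ × ℝ |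
        ENNReal.ofReal (γ * p.1 ^ 4 / Ptx) * p.2.1 < ENNReal.ofReal p.2.2})
      = ENNReal.ofReal (Real.exp (-(pA * √γ * Real.pi / 2 * ρ * (Real.pi * x ^ 2)))) := by
    filter_upwards [hpos] with x hx
    rw [Measure.map_apply (hI.prodMk hh) (measurable_prodMk_left hset), mul_assoc _ ρ]
    exact measure_scaled_interference_lt hΨ hρ hpA hζ hPtx hγ hx hh hlaw hIh
  rw [lintegral_congr_ae hinner, hr'law, lintegral_map (by fun_prop) measurable_cell_loc.norm]

end Coverage

theorem theorem1 {Ω : Type*} [MeasurableSpace Ω] (P : Measure Ω) [IsProbabilityMeasure P]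
    (ρ pI pA pS μ lamS ζ Ptx R w γ : ℝ)
    (hρ : 0 < ρ) (hpI : 0 < pI) (hpA : 0 < pA) (hpS : 0 ≤ pS) (hp : pI + pA + pS = 1)
    (hμ : 0 < μ) (hlamS : 0 < lamS) (hζ : 0 < ζ) (hPtx : 0 < Ptx)
    (hR : 0 < R) (hw : 0 ≤ w) (hγ : 0 < γ)
    (Φ : Ω → Set Cell) (Ψ : Ω → Set (Plane × ℝ)) (h : Ω → ℝ)
    (hΦ : IsPoissonPP Φ (cellIntensity ρ pI pA pS μ lamS) P)
    (hΨ : IsPoissonPP Ψ (interfererIntensity ρ pA ζ) P)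
    (hh : Measurable h) (hlaw : HasLaw h (expMeasure ζ) P)
    (hind : iIndep ![pointSigma Φ, pointSigma Ψ, MeasurableSpace.comap h inferInstance] P)
    (θ v : ℝ) (β : ℝ → ℝ)
    (hθ : θ = pA * Real.sqrt γ * Real.pi / 2)
    (hv : v = ρ * Real.pi * R ^ 2)
    (hβ : ∀ t, β t = 1 - pA * Real.exp (-μ * t) - pS * Real.exp (-lamS * t)) :
    coverageProb P Φ Ψ h Ptx 4 0 R w γ =
      β 0 / (θ + β 0) +
        (Real.exp (-β 0 * v) - Real.exp (-β w * v)) *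
          (1 / (θ * v) - Real.exp (-θ * v) * (β 0 / (θ + β 0) + 1 / (θ * v))) := by
  have hβ0 : β 0 = pI := by
    rw [hβ]; simp only [mul_zero, Real.exp_zero]; linarith
  have hβw : β w = pI + delayedProb pA pS μ lamS w := by
    rw [hβ, delayedProb, neg_mul, neg_mul]; linarith
  have hB : 0 ≤ delayedProb pA pS μ lamS w :=
    delayedProb_nonneg hpA.le hpS hμ.le hlamS.le hw
  have hθpos : 0 < θ := by rw [hθ]; positivity
  have hκ : 0 < θ * ρ := by positivity
  have hV : 0 < Real.pi * R ^ 2 := by positivity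
  have hle : Real.exp (-(θ * ρ * (Real.pi * R ^ 2))) ≤ 1 :=
    Real.exp_le_one_iff.2 (neg_nonpos.2 (by positivity))
  have hD0 : 0 ≤ (1 - Real.exp (-(θ * ρ * (Real.pi * R ^ 2)))) / (θ * ρ) :=
    div_nonneg (by linarith) hκ.le
  have hmain := measure_covered hρ hpI hpA hpS hμ hlamS hR hw hζ hPtx hγ hΦ hΨ hh hlaw.map_eq hind
  -- Here `κ = θ * ρ`, and `D` is the integral of `exp (-(κ * u))` over the area interval of the
  -- disc.
  rw [← hθ, lintegral_firstPointLaw_area hρ hpI hpA hpS hμ hlamS hR hw hκ.le hD0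
    (by rw [setLIntegral_Ioc_exp hκ hV.le]; simp)] at hmain
  rw [coverageProb, Measure.real, hmain, ENNReal.toReal_ofReal, hβ0, hβw]
  · have hvV : v = ρ * (Real.pi * R ^ 2) := by rw [hv]; ring
    set V := Real.pi * R ^ 2 with hVdef
    set B := delayedProb pA pS μ lamS w
    have e1 : Real.exp (-((θ * ρ + ρ * pI) * V)) = Real.exp (-θ * v) * Real.exp (-pI * v) := by
      rw [← Real.exp_add, hvV]; ring_nf
    have e2 : Real.exp (-(ρ * V * B)) * Real.exp (-((θ * ρ + ρ * pI) * V))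
        = Real.exp (-θ * v) * Real.exp (-(pI + B) * v) := by
      rw [← Real.exp_add, ← Real.exp_add, hvV]; ring_nf
    have e3 : Real.exp (-(ρ * V * pI)) = Real.exp (-pI * v) := by rw [hvV]; ring_nf
    have e4 : Real.exp (-(ρ * V * (pI + B))) = Real.exp (-(pI + B) * v) := by rw [hvV]; ring_nf
    have e5 : Real.exp (-(θ * ρ * V)) = Real.exp (-θ * v) := by rw [hvV]; ring_nf
    have hsum : θ + pI ≠ 0 := by positivity
    rw [e2, e1, e3, e4, e5]
    -- With the exponentials rewritten through `x`, `y`, `z`, the claim is an identity of rational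
    -- functions.
    generalize Real.exp (-θ * v) = x
    generalize Real.exp (-pI * v) = y
    generalize Real.exp (-(pI + B) * v) = z
    rw [hvV, show θ * ρ + ρ * pI = ρ * (θ + pI) by ring]
    field_simp
    ring
  · have h1 : Real.exp (-((θ * ρ + ρ * pI) * (Real.pi * R ^ 2))) ≤ 1 :=
      Real.exp_le_one_iff.2 (neg_nonpos.2 (by positivity))
    have h2 : Real.exp (-(ρ * (Real.pi * R ^ 2) * (pI + delayedProb pA pS μ lamS w)))
        ≤ Real.exp (-(ρ * (Real.pi * R ^ 2) * pI)) :=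
      Real.exp_le_exp.2 (neg_le_neg (mul_le_mul_of_nonneg_left (by linarith) (by positivity)))
    refine add_nonneg (mul_nonneg (by positivity) (add_nonneg (by linarith) (by positivity))) ?_
    exact mul_nonneg (div_nonneg hD0 hV.le) (by linarith)
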